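/- **Setting.** Let $G=(V,E)$ be a finite simple $d$-regular graph with $n\ge 1$ nodes. Add $d^\circ$ self-loops to every node; the result is the balancing graph $G^+$, of degree $d^+=d+d^\circ$. Every node $u$ sends tokens over its $d$ original edges and its $d^\circ$ self-loops. A load balancing algorithm (balancer) on $G^+$ determines, for every initial load vector $x_1\in\mathbb{N}^V$ and every step $t\ge 1$, the numbers $f_t(e)\in\mathbb{N}$ of tokens that each node $u$ sends in step $t$ over each of its $d^+$ edges $e$; these sum to the load $x_t(u)$ of $u$ at the beginning of step $t$, and $x_{t+1}(u)$ is the number of tokens that arrive at $u$ in step $t$ (over edges and self-loops). Put $F_t(e)=\sum_{\tau\le t}f_\tau(e)$. For real $\delta$, the balancer is cumulatively $\delta$-fair if for every initial load, every step $t$ and every node $u$, each of the $d^+$ edges of $u$ (self-loops included) receives at least $\lfloor x_t(u)/d^+\rfloor$ tokens in step $t$, and $|F_t(e_1)-F_t(e_2)|\le\delta$ for all original edges $e_1,e_2$ of $u$. The discrepancy of a load vector is its maximum minus its minimum; $K$ is the discrepancy of $x_1$. Let $P$ be the transition matrix of the random walk on $G^+$, that is, $P(u,v)=1/d^+$ if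 $uv\in E$, $P(u,u)=d^\circ/d^+$, and $P(u,v)=0$ otherwise. Let $\lambda_1\ge\dots\ge\lambda_n$ be its eigenvalues, with multiplicity, and let $\mu=1-\max_{i\ge2}|\lambda_i|$ be its eigenvalue gap (with $\mu=1$ if $n=1$). **Theorem 1.** There is an absolute constant $C_1>0$, and for every $c$ there is a constant $C_2>0$ depending only on $c$, such that the following holds for every $d$-regular graph $G$ and every number $d^\circ\le c\,d$ of self-loops with $\mu>0$, every real $\delta$, every cumulatively $\delta$-fair balancer on $G^+$ and every initial load vector. After any number $t\ge C_1\log(Kn)/\mu$ of steps (any $t\ge 0$ if $K=0$), the discrepancy of the load vector is at most (i) $C_2\,(\delta+1)\,d\,\sqrt{\log n/\mu}$ if $d^+\ge 2d$; (ii) $C_2\,(\delta+1)\,d\,\sqrt{n}$ if $d^+\ge 2d$; (iii) $C_2\,(\delta+1)\,d\,\log n/\mu$ if $d^+\ge d+1$. -/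

import Mathlib

namespace LoadBalancing

/-- The edges along which the node `u` sends tokens in the balancing graph `G⁺`: the original edges
from `u` to its neighbours in `G`, and `s` self-loops. -/
abbrev OutEdge {V : Type*} (G : SimpleGraph V) (s : ℕ) (u : V) : Type _ :=
  G.neighborSet u ⊕ Fin s

/-- The numbers of tokens sent in one step along all the edges of the balancing graph. -/
abbrev Flow {V : Type*} (G : SimpleGraph V) (s : ℕ) : Type _ :=
  ∀ u : V, OutEdge G s u → ℕ

section Model

variable {V : Type*} [Fintype V] {G : SimpleGraph V} [DecidableRel G.Adj] {s : ℕ}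

/-- The number of tokens that leave `u`, the tokens sent over the self-loops of `u` included. -/
def Flow.outflow (f : Flow G s) (u : V) : ℕ := ∑ e : OutEdge G s u, f u e

/-- The number of tokens that arrive at `u`: from the neighbours of `u` in `G`, and over the
self-loops of `u`. -/
def Flow.inflow (f : Flow G s) (u : V) : ℕ :=
  ∑ v : G.neighborSet u, f v.1 (Sum.inl ⟨u, SimpleGraph.Adj.symm v.2⟩) + ∑ i : Fin s, f u (Sum.inr i)

/-- The load vector after `t` steps, if the initial load is `x` and `f t` is the flow in the step
that follows the first `t` steps. -/
def loadAfter (f : ℕ → Flow G s) (x : V → ℕ) : ℕ → V → ℕ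
  | 0 => x
  | t + 1 => (f t).inflow

end Model

/-- A load balancing algorithm on the graph `G` with `s` self-loops added at every node. It
determines, for every initial load vector `x`, the flow `flow x t` in each step; a node sends
precisely the tokens that it holds. (The flow may depend on the whole past in any way.) -/
structure Balancer {V : Type*} [Fintype V] (G : SimpleGraph V) [DecidableRel G.Adj] (s : ℕ) where
  flow : (V → ℕ) → ℕ → Flow G s
  outflow_eq : ∀ (x : V → ℕ) (t : ℕ) (u : V), (flow x t).outflow u = loadAfter (flow x) x t u

namespace Balancer

variable {V : Type*} [Fintype V] {G : SimpleGraph V} [DecidableRel G.Adj] {s : ℕ}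

/-- The load vector after `t` steps, from the initial load vector `x`. -/
def load (A : Balancer G s) (x : V → ℕ) (t : ℕ) : V → ℕ := loadAfter (A.flow x) x t

/-- The number of tokens sent over the edge `e` in the first `t` steps. -/
def cumFlow (A : Balancer G s) (x : V → ℕ) (t : ℕ) (u : V) (e : OutEdge G s u) : ℕ :=
  ∑ τ ∈ Finset.range t, A.flow x τ u e

/-- Cumulative `δ`-fairness: in every step each of the `d⁺ = deg u + s` edges of `u`, self-loops
included, receives at least `⌊load / d⁺⌋` tokens, and at any time the cumulative flows over any two
original edges of `u` differ by at most `δ`. -/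
def IsCumulativelyFair (A : Balancer G s) (δ : ℝ) : Prop :=
  ∀ (x : V → ℕ) (t : ℕ) (u : V),
    (∀ e : OutEdge G s u, A.load x t u / (G.degree u + s) ≤ A.flow x t u e) ∧
    (∀ v w : G.neighborSet u,
      |(A.cumFlow x t u (Sum.inl v) : ℝ) - (A.cumFlow x t u (Sum.inl w) : ℝ)| ≤ δ)

end Balancer

/-- The discrepancy of a load vector: maximal load minus minimal load. -/
noncomputable def discrepancy {V : Type*} [Fintype V] [Nonempty V] (x : V → ℕ) : ℝ :=
  (Finset.univ.sup' Finset.univ_nonempty x : ℕ) - (Finset.univ.inf' Finset.univ_nonempty x : ℕ)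

section Spectrum

variable {V : Type*} [DecidableEq V] (G : SimpleGraph V) [DecidableRel G.Adj] (d s : ℕ)

/-- The transition matrix of the random walk on the balancing graph of a `d`-regular graph with
`s` self-loops at every node. -/
noncomputable def transitionMatrix : Matrix V V ℝ :=
  Matrix.of fun u v =>
    if u = v then (s : ℝ) / (d + s : ℕ) else if G.Adj u v then 1 / ((d + s : ℕ) : ℝ) else 0

theorem transitionMatrix_isHermitian : (transitionMatrix G d s).IsHermitian := by
  ext u v
  simp [transitionMatrix, Matrix.conjTranspose_apply, G.adj_comm u v, eq_comm (a := u) (b := v)]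

/-- The eigenvalue gap `1 - max_{i ≥ 2} |λ_i|`, where `λ_1 ≥ λ_2 ≥ … ≥ λ_n` are the eigenvalues of
the transition matrix, listed with multiplicity (in Lean the index of `λ_1` is `0`). -/
noncomputable def spectralGap [Fintype V] : ℝ :=
  1 - ⨆ i : {i : Fin (Fintype.card V) // 0 < i.val},
    |(transitionMatrix_isHermitian G d s).eigenvalues₀ i.1|

end Spectrum

end LoadBalancing

namespace LoadBalancing

/-! Let `T` be the walk operator in the supremum norm and `D = d + s`. Write the load as `D` times
the mean flow per original edge plus a remainder `r`. Then one step reads `x (t + 1) = T (x t) + (r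
t - T (r t)) + η t` (`Balancer.load_succ`). The floor condition bounds `r` by `D ^ 2 / d`.
Cumulative fairness bounds the partial sums of `η`, over any length of time, by `d * δ`. Abel
summation turns both errors into terms `T ^ k * (1 - T)` applied to bounded vectors, so the distance
of `x t` from `T ^ t (x 0)` is controlled by `∑ ‖T ^ k * (1 - T)‖`
(`Balancer.IsCumulativelyFair.discrepancy_load_le`), while `T ^ t (x 0)` is within 1 of a constant
after the mixing time.

It remains to bound this sum in three ways. The norms halve every `O(log n / μ)` steps, so only that
many terms count; bounding each by 2 gives (iii). If `d ≤ s`, then `2 * T - 1` is a contraction and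
the `k`-th norm is at most `2 / √(k + 1)` (`norm_lazy_pow_mul_one_sub_le'`), which gives (i). For
(ii) this bound serves for `k < n`; beyond that a Nash-type inequality yields decay of order `√n * D
^ (1/4) * k ^ (-5/4)` (`norm_walkOp_pow_mul_one_sub_le_of_two_le`), with tail `O(√n)` because `D =
O(n)`. -/

/-! ### Binomial coefficients. -/

theorem centralBinom_sq_mul_le (m : ℕ) : m.centralBinom ^ 2 * (2 * m + 1) ≤ (4 ^ m) ^ 2 := by
  induction m with
  | zero => simp
  | succ m ih =>
    have h := Nat.succ_mul_centralBinom_succ m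
    have h2 : (m + 1) ^ 2 * ((m + 1).centralBinom ^ 2 * (2 * (m + 1) + 1)) ≤
        (m + 1) ^ 2 * (4 ^ (m + 1)) ^ 2 := by
      calc (m + 1) ^ 2 * ((m + 1).centralBinom ^ 2 * (2 * (m + 1) + 1))
          = ((m + 1) * (m + 1).centralBinom) ^ 2 * (2 * (m + 1) + 1) := by ring
        _ = 4 * (2 * m + 1) * (2 * m + 3) * (m.centralBinom ^ 2 * (2 * m + 1)) := by
          rw [h]; ring
        _ ≤ 4 * (2 * m + 1) * (2 * m + 3) * (4 ^ m) ^ 2 := by gcongr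
        _ ≤ 16 * (m + 1) ^ 2 * (4 ^ m) ^ 2 := by gcongr ?_ * _; nlinarith
        _ = _ := by ring
    exact Nat.le_of_mul_le_mul_left h2 (by positivity)

theorem choose_two_mul_le_succ {m j : ℕ} (hj : j < m) :
    (2 * m).choose j ≤ (2 * m).choose (j + 1) :=
  Nat.choose_le_succ_of_lt_half_left (by omega)

theorem choose_two_mul_succ_le {m j : ℕ} (hj : m ≤ j) :
    (2 * m).choose (j + 1) ≤ (2 * m).choose j := by
  rcases le_or_gt (2 * m) j with h | h
  · rw [Nat.choose_eq_zero_of_lt (by omega)]; exact Nat.zero_le _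
  · rw [← Nat.choose_symm (k := j + 1) (by omega), ← Nat.choose_symm (k := j) h.le]
    have := choose_two_mul_le_succ (m := m) (j := 2 * m - (j + 1)) (by omega)
    rwa [show 2 * m - (j + 1) + 1 = 2 * m - j by omega] at this

/-- The row `2 * m` rises from 1 to its central entry and then falls to 0, so both halves telescope.
-/
theorem sum_abs_choose_sub (m : ℕ) :
    ∑ j ∈ Finset.range (2 * m + 1), |((2 * m).choose (j + 1) : ℝ) - (2 * m).choose j| =
      2 * m.centralBinom - 1 := by
  have h1 : ∑ j ∈ Finset.range m, |((2 * m).choose (j + 1) : ℝ) - (2 * m).choose j| =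
      m.centralBinom - 1 := by
    rw [Finset.sum_congr rfl fun j hj => abs_of_nonneg (sub_nonneg.2 (by
      exact_mod_cast choose_two_mul_le_succ (Finset.mem_range.1 hj))),
      Finset.sum_range_sub (fun j => ((2 * m).choose j : ℝ))]
    simp [Nat.centralBinom]
  have h2 : ∑ j ∈ Finset.range (m + 1),
      |((2 * m).choose (m + j + 1) : ℝ) - (2 * m).choose (m + j)| = m.centralBinom := by
    have h := Finset.sum_range_sub' (fun j => ((2 * m).choose (m + j) : ℝ)) (m + 1)
    simp only [← add_assoc] at h
    rw [Finset.sum_congr rfl fun j _ => (abs_sub_comm _ _).trans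
      (abs_of_nonneg (sub_nonneg.2 (by
        exact_mod_cast choose_two_mul_succ_le (Nat.le_add_right m j)))), h, add_assoc,
      Nat.choose_eq_zero_of_lt (by omega : 2 * m < m + (m + 1))]
    simp [Nat.centralBinom]
  rw [show 2 * m + 1 = m + (m + 1) by ring, Finset.sum_range_add, h1, h2]
  ring

/-! ### Powers of lazy contractions. -/

section NormedAlgebra

variable {E : Type*} [NormedRing E] [NormedAlgebra ℝ E]

theorem one_add_pow_mul_one_sub (q : E) (N : ℕ) :
    (1 + q) ^ N * (1 - q) =
      1 + ∑ j ∈ Finset.range (N + 1), ((N.choose (j + 1) : ℝ) - N.choose j) • q ^ (j + 1) := by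
  have h : (1 + q) ^ N = ∑ j ∈ Finset.range (N + 1), (N.choose j : ℝ) • q ^ j := by
    rw [add_comm, (Commute.one_right q).add_pow]
    refine Finset.sum_congr rfl fun j _ => ?_
    rw [one_pow, mul_one, ← Nat.cast_comm, Nat.cast_smul_eq_nsmul, nsmul_eq_mul]
  have h' : (1 + q) ^ N = 1 + ∑ j ∈ Finset.range (N + 1), (N.choose (j + 1) : ℝ) • q ^ (j + 1) := by
    rw [h, Finset.sum_range_succ', Finset.sum_range_succ _ N]
    simp [add_comm]
  rw [mul_sub, mul_one]
  nth_rewrite 1 [h']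
  rw [h, Finset.sum_mul, add_sub_assoc, ← Finset.sum_sub_distrib]
  congr 1
  refine Finset.sum_congr rfl fun j _ => ?_
  rw [smul_mul_assoc, ← pow_succ, sub_smul]

/-- The powers of a lazy contraction vary slowly. -/
theorem norm_lazy_pow_mul_one_sub_le [NormOneClass E] (p : E) (hq : ‖2 * p - 1‖ ≤ 1) (m : ℕ) :
    ‖p ^ (2 * m) * (1 - p)‖ ≤ 1 / √(2 * m + 1) := by
  -- With `p = (1 + q) / 2` and `q` a contraction, the norm is at most the total variation of the
  -- coefficients of `(1 + q) ^ (2 * m)`, scaled by `1 / (2 * 4 ^ m)`.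
  set q := 2 * p - 1 with hqdef
  have hqpow : ∀ j, ‖q ^ j‖ ≤ 1 := fun j => (norm_pow_le q j).trans (pow_le_one₀ (norm_nonneg _) hq)
  have e1 : (1 + q) ^ (2 * m) * (1 - q) = (2 * 4 ^ m : ℝ) • (p ^ (2 * m) * (1 - p)) := by
    have a1 : 1 + q = (2 : ℝ) • p := by rw [hqdef, two_smul, two_mul]; abel
    have a2 : 1 - q = (2 : ℝ) • (1 - p) := by rw [hqdef, two_smul, two_mul]; abel
    rw [a1, a2, smul_pow, smul_mul_smul_comm, pow_mul]
    norm_num [mul_comm]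
  have e2 : ‖(1 + q) ^ (2 * m) * (1 - q)‖ ≤ 2 * m.centralBinom := by
    rw [one_add_pow_mul_one_sub]
    calc _ ≤ ‖(1 : E)‖ + ∑ j ∈ Finset.range (2 * m + 1),
          ‖(((2 * m).choose (j + 1) : ℝ) - (2 * m).choose j) • q ^ (j + 1)‖ :=
          (norm_add_le _ _).trans (by gcongr; exact norm_sum_le _ _)
      _ ≤ 1 + ∑ j ∈ Finset.range (2 * m + 1),
          |((2 * m).choose (j + 1) : ℝ) - (2 * m).choose j| := by
          rw [norm_one]
          gcongr with j
          rw [norm_smul, Real.norm_eq_abs]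
          exact mul_le_of_le_one_right (abs_nonneg _) (hqpow _)
      _ = _ := by rw [sum_abs_choose_sub]; ring
  rw [e1, norm_smul, Real.norm_of_nonneg (by positivity)] at e2
  have e3 : (m.centralBinom : ℝ) * √(2 * m + 1) ≤ 4 ^ m := by
    refine abs_le_of_sq_le_sq' ?_ (by positivity) |>.2
    rw [mul_pow, Real.sq_sqrt (by positivity)]
    exact_mod_cast centralBinom_sq_mul_le m
  rw [le_div_iff₀ (by positivity)]
  have h4 : (0 : ℝ) < 4 ^ m := by positivity
  have hs : 0 ≤ √(2 * (m : ℝ) + 1) := Real.sqrt_nonneg _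
  have e4 : 4 ^ m * ‖p ^ (2 * m) * (1 - p)‖ ≤ m.centralBinom := by linarith
  have := mul_le_mul_of_nonneg_right e4 hs
  nlinarith

theorem norm_lazy_pow_mul_one_sub_le' [NormOneClass E] (p : E) (hp : ‖p‖ ≤ 1)
    (hq : ‖2 * p - 1‖ ≤ 1) (k : ℕ) : ‖p ^ k * (1 - p)‖ ≤ 2 / √(k + 1) := by
  have key : ∀ m : ℕ, k ≤ 2 * m + 1 → 1 / √(2 * m + 1) ≤ 2 / √((k : ℝ) + 1) := by
    intro m hm
    rw [div_le_div_iff₀ (by positivity) (by positivity), one_mul,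
      show (2 : ℝ) = √4 by rw [show (4 : ℝ) = 2 ^ 2 by norm_num]; simp,
      ← Real.sqrt_mul (by norm_num)]
    apply Real.sqrt_le_sqrt
    have : (k : ℝ) ≤ 2 * m + 1 := by exact_mod_cast hm
    rw [← show (2 : ℝ) = √4 by rw [show (4 : ℝ) = 2 ^ 2 by norm_num]; simp]
    linarith [(Nat.cast_nonneg m : (0 : ℝ) ≤ m)]
  obtain ⟨m, rfl | rfl⟩ := k.even_or_odd'
  · exact (norm_lazy_pow_mul_one_sub_le p hq m).trans (key m (by omega))
  · refine le_trans ?_ (key m le_rfl)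
    rw [pow_succ', mul_assoc]
    calc _ ≤ ‖p‖ * ‖p ^ (2 * m) * (1 - p)‖ := norm_mul_le _ _
      _ ≤ _ := (mul_le_of_le_one_left (norm_nonneg _) hp).trans
        (norm_lazy_pow_mul_one_sub_le p hq m)

end NormedAlgebra

/-! ### Estimates for real sequences and sums. -/

theorem sum_inv_sqrt_succ_le (N : ℕ) : ∑ k ∈ Finset.range N, 1 / √((k : ℝ) + 1) ≤ 2 * √N := by
  induction N with
  | zero => simp
  | succ N ih =>
    rw [Finset.sum_range_succ]
    push_cast
    have h0 : (0 : ℝ) ≤ N := Nat.cast_nonneg N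
    have ha := Real.sq_sqrt h0
    have hb := Real.sq_sqrt (by linarith : (0 : ℝ) ≤ N + 1)
    have hbpos : 0 < √((N : ℝ) + 1) := by positivity
    have : 1 / √((N : ℝ) + 1) ≤ 2 * √((N : ℝ) + 1) - 2 * √N := by
      rw [div_le_iff₀ hbpos]
      nlinarith [sq_nonneg (√((N : ℝ) + 1) - √N)]
    linarith

/-- If `b` is halved after `m` steps, its partial sums are controlled by the first `m` terms. -/
theorem sum_range_le_two_mul_of_halving {b : ℕ → ℝ} (hb : ∀ k, 0 ≤ b k) {m : ℕ}
    (h : ∀ k, b (m + k) ≤ b k / 2) (N : ℕ) :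
    ∑ k ∈ Finset.range N, b k ≤ 2 * ∑ k ∈ Finset.range m, b k := by
  have h1 : ∑ k ∈ Finset.range N, b k ≤ ∑ k ∈ Finset.range (m + N), b k :=
    Finset.sum_le_sum_of_subset_of_nonneg (by simp) fun k _ _ => hb k
  have h2 : ∑ k ∈ Finset.range N, b (m + k) ≤ (∑ k ∈ Finset.range N, b k) / 2 := by
    rw [Finset.sum_div]
    exact Finset.sum_le_sum fun k _ => h k
  rw [Finset.sum_range_add] at h1
  linarith

/-- A sequence that decreases at a cubic rate decays like the inverse square root. -/
theorem sq_mul_le_of_cubic_decrease {a : ℕ → ℝ} {κ : ℝ} (hκ : 0 ≤ κ) (ha : ∀ k, 0 ≤ a k)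
    (h : ∀ k, κ * a k ^ 3 ≤ a k - a (k + 1)) (k : ℕ) : a k ^ 2 * (2 * κ * k) ≤ 1 := by
  induction k with
  | zero => simp
  | succ k ih =>
    have h0 := ha k
    have h1 := ha (k + 1)
    have hk := h k
    have hle : a (k + 1) ≤ a k * (1 - κ * a k ^ 2) := by nlinarith
    set y := κ * a k ^ 2 with hy
    have hy0 : 0 ≤ y := by positivity
    have hsq : a (k + 1) ^ 2 ≤ (a k * (1 - y)) ^ 2 := pow_le_pow_left₀ h1 hle 2
    push_cast
    rcases h0.eq_or_lt with h0 | h0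
    · rw [← h0] at hsq
      have : a (k + 1) ^ 2 = 0 := le_antisymm (by simpa using hsq) (sq_nonneg _)
      rw [this]; norm_num
    have hy1 : y ≤ 1 := by nlinarith
    -- The induction closes because `(1 - y) ^ 2 * (1 + 2 * y) = 1 - 3 * y ^ 2 + 2 * y ^ 3 ≤ 1` on
    -- `[0, 1]`.
    calc a (k + 1) ^ 2 * (2 * κ * (k + 1)) ≤ (a k * (1 - y)) ^ 2 * (2 * κ * (k + 1)) := by gcongr
      _ = (1 - y) ^ 2 * (a k ^ 2 * (2 * κ * k)) + 2 * y * (1 - y) ^ 2 := by rw [hy]; ring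
      _ ≤ (1 - y) ^ 2 * 1 + 2 * y * (1 - y) ^ 2 := by gcongr
      _ ≤ 1 := by nlinarith [mul_nonneg (sq_nonneg y) (sub_nonneg.2 hy1)]

/-- Comparison of `k ^ (-5/4)` with the telescoping differences of `8 * k ^ (-1/4)`; the fourth
roots `a`, `b` of `k`, `k + 1` satisfy `b ^ 4 - a ^ 4 = 1` and `b ^ 4 ≤ 2 * a ^ 4`. -/
theorem sum_Ico_inv_mul_fourthRoot_le {m : ℕ} (hm : 0 < m) (N : ℕ) :
    ∑ k ∈ Finset.Ico m N, 1 / ((k : ℝ) * √√(k : ℝ)) ≤ 8 / √√(m : ℝ) := by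
  have key : ∀ k : ℕ, 0 < k →
      1 / ((k : ℝ) * √√(k : ℝ)) ≤ 8 / √√(k : ℝ) - 8 / √√((k + 1 : ℕ) : ℝ) := by
    intro k hk
    have hk' : (1 : ℝ) ≤ k := by exact_mod_cast hk
    have ha : 0 < √√(k : ℝ) := by positivity
    have ha4 : √√(k : ℝ) ^ 4 = k := by
      rw [show 4 = 2 * 2 by norm_num, pow_mul, Real.sq_sqrt (by positivity),
        Real.sq_sqrt (by positivity)]
    have hb : 0 < √√((k + 1 : ℕ) : ℝ) := by positivity
    have hb4 : √√((k + 1 : ℕ) : ℝ) ^ 4 = k + 1 := by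
      rw [show 4 = 2 * 2 by norm_num, pow_mul, Real.sq_sqrt (by positivity),
        Real.sq_sqrt (by positivity)]
      push_cast; ring
    have hab : √√(k : ℝ) ≤ √√((k + 1 : ℕ) : ℝ) := by gcongr; simp
    set a := √√(k : ℝ)
    set b := √√((k + 1 : ℕ) : ℝ)
    rw [← ha4] at hb4 hk' ⊢
    rw [div_sub_div _ _ ha.ne' hb.ne', div_le_div_iff₀ (by positivity) (by positivity)]
    have h1 : (b - a) * (4 * b ^ 3) ≥ 1 := by
      have e : (b - a) * (b ^ 3 + b ^ 2 * a + b * a ^ 2 + a ^ 3) = 1 := by linear_combination hb4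
      have h2 : b ^ 3 + b ^ 2 * a + b * a ^ 2 + a ^ 3 ≤ 4 * b ^ 3 := by
        have : b ^ 2 * a ≤ b ^ 2 * b := by gcongr
        have : b * a ^ 2 ≤ b * b ^ 2 := by gcongr
        have : a ^ 3 ≤ b ^ 3 := by gcongr
        linarith
      rw [← e]
      exact mul_le_mul_of_nonneg_left h2 (sub_nonneg.2 hab)
    have h3 : b ^ 4 ≤ 2 * a ^ 4 := by linarith
    have hba := sub_nonneg.2 hab
    have : a * b ≤ 8 * (b - a) * (a ^ 4 * a) := by
      calc a * b ≤ a * b * ((b - a) * (4 * b ^ 3)) := le_mul_of_one_le_right (by positivity) h1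
        _ = 4 * (b - a) * a * b ^ 4 := by ring
        _ ≤ 4 * (b - a) * a * (2 * a ^ 4) := by gcongr
        _ = _ := by ring
    linarith
  rcases le_total N m with h | h
  · rw [Finset.Ico_eq_empty_of_le h]; simp; positivity
  calc _ ≤ ∑ k ∈ Finset.Ico m N, (8 / √√(k : ℝ) - 8 / √√((k + 1 : ℕ) : ℝ)) :=
        Finset.sum_le_sum fun k hk => key k (hm.trans_le (Finset.mem_Ico.1 hk).1)
    _ = 8 / √√(m : ℝ) - 8 / √√(N : ℝ) := by
        have := Finset.sum_Ico_sub (fun k : ℕ => -(8 / √√(k : ℝ))) h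
        rw [show 8 / √√(m : ℝ) - 8 / √√(N : ℝ) = -(8 / √√(N : ℝ)) - -(8 / √√(m : ℝ)) by ring,
          ← this]
        exact Finset.sum_congr rfl fun k _ => by ring
    _ ≤ _ := sub_le_self _ (by positivity)


open Matrix

/-! ### Expansion in an orthonormal eigenbasis. -/

section Spectral

variable {V : Type*} [Fintype V] [DecidableEq V] {M : Matrix V V ℝ}

/-- The coordinate of `f` along the `i`-th vector of an orthonormal eigenbasis of `M`. -/
noncomputable def eigencoord (hM : M.IsHermitian) (i : V) (f : V → ℝ) : ℝ :=
  f ⬝ᵥ (hM.eigenvectorBasis i).ofLp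

theorem sum_eigencoord_mul (hM : M.IsHermitian) (f g : V → ℝ) :
    ∑ i, eigencoord hM i f * eigencoord hM i g = f ⬝ᵥ g := by
  have h := hM.eigenvectorBasis.sum_inner_mul_inner (WithLp.toLp 2 f) (WithLp.toLp 2 g)
  simp only [EuclideanSpace.inner_eq_star_dotProduct, star_trivial] at h
  rw [dotProduct_comm f g, ← h]
  refine Finset.sum_congr rfl fun i _ => ?_
  rw [eigencoord, eigencoord, dotProduct_comm f]

theorem sum_eigencoord_sq (hM : M.IsHermitian) (f : V → ℝ) :
    ∑ i, eigencoord hM i f ^ 2 = f ⬝ᵥ f := by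
  simp_rw [sq, sum_eigencoord_mul]

theorem eigencoord_mulVec (hM : M.IsHermitian) (i : V) (f : V → ℝ) :
    eigencoord hM i (M *ᵥ f) = hM.eigenvalues i * eigencoord hM i f := by
  have hT : Mᵀ = M := by rw [← conjTranspose_eq_transpose_of_trivial]; exact hM
  have h := hM.mulVec_eigenvectorBasis i
  rw [eigencoord, ← vecMul_transpose, hT, ← dotProduct_mulVec]
  rw [h, dotProduct_smul]; rfl

theorem eigencoord_sub (hM : M.IsHermitian) (i : V) (f g : V → ℝ) :
    eigencoord hM i (f - g) = eigencoord hM i f - eigencoord hM i g := sub_dotProduct _ _ _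

/-- If `a M - b` is a contraction, its eigenvalues lie in `[-1, 1]`. -/
theorem abs_affine_eigenvalue_le (hM : M.IsHermitian) (a b : ℝ)
    (h : ∀ f : V → ℝ, ‖a • (M *ᵥ f) - b • f‖ ≤ ‖f‖) (i : V) :
    |a * hM.eigenvalues i - b| ≤ 1 := by
  have hne : (hM.eigenvectorBasis i).ofLp ≠ 0 := by
    intro h0
    have h1 := hM.eigenvectorBasis.orthonormal.ne_zero i
    exact h1 (by ext v; exact congrFun h0 v)
  have h2 := h (hM.eigenvectorBasis i).ofLp
  rw [hM.mulVec_eigenvectorBasis i, smul_smul, ← sub_smul, norm_smul, Real.norm_eq_abs] at h2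
  exact le_of_mul_le_mul_right (by simpa using h2) (norm_pos_iff.2 hne)

end Spectral

/-! ### The random walk on the balancing graph. -/

section Walk

variable {V : Type*} [Fintype V] [DecidableEq V] (G : SimpleGraph V) [DecidableRel G.Adj]
  (d s : ℕ)

theorem transitionMatrix_mulVec_apply (f : V → ℝ) (u : V) :
    (transitionMatrix G d s *ᵥ f) u =
      (s * f u + ∑ v ∈ G.neighborFinset u, f v) / ((d + s : ℕ) : ℝ) := by
  have h : ∀ v, transitionMatrix G d s u v * f v =
      (if u = v then (s : ℝ) * f u / ((d + s : ℕ) : ℝ) else 0) +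
        if G.Adj u v then f v / ((d + s : ℕ) : ℝ) else 0 := by
    intro v
    rcases eq_or_ne u v with rfl | hne
    · simp [transitionMatrix]; ring
    · by_cases ha : G.Adj u v
      · simp [transitionMatrix, hne, ha]; ring
      · simp [transitionMatrix, hne, ha]
  simp only [mulVec, dotProduct, h, Finset.sum_add_distrib, Finset.sum_ite_eq, Finset.mem_univ,
    if_true, ← Finset.sum_filter]
  rw [add_div, Finset.sum_div, SimpleGraph.neighborFinset_eq_filter]

/-- The transition matrix as an operator on functions with the supremum norm. -/
noncomputable def walkOp : (V → ℝ) →L[ℝ] (V → ℝ) :=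
  LinearMap.toContinuousLinearMap (transitionMatrix G d s).mulVecLin

theorem walkOp_apply (f : V → ℝ) (u : V) :
    walkOp G d s f u = (s * f u + ∑ v ∈ G.neighborFinset u, f v) / ((d + s : ℕ) : ℝ) :=
  transitionMatrix_mulVec_apply G d s f u

/-- The eigenvalues of the transition matrix, indexed by the nodes. -/
noncomputable abbrev walkEig (i : V) : ℝ := (transitionMatrix_isHermitian G d s).eigenvalues i

/-- The coordinates of a function in an eigenbasis of the transition matrix. -/
noncomputable abbrev walkCoord (i : V) (f : V → ℝ) : ℝ :=
  eigencoord (transitionMatrix_isHermitian G d s) i f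

theorem spectralGap_le_one : spectralGap G d s ≤ 1 :=
  sub_le_self _ (Real.iSup_nonneg fun _ => abs_nonneg _)

/-- The gap refers to the sorted list of eigenvalues, the eigenbasis to nodes; `i₀` is the node that
carries the first eigenvalue of the list. -/
theorem exists_abs_walkEig_le [Nonempty V] :
    ∃ i₀ : V, ∀ i, i ≠ i₀ → |walkEig G d s i| ≤ 1 - spectralGap G d s := by
  refine ⟨Fintype.equivOfCardEq (Fintype.card_fin _) ⟨0, Fintype.card_pos⟩, fun i hi => ?_⟩
  set j := (Fintype.equivOfCardEq (Fintype.card_fin (Fintype.card V))).symm i with hj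
  have hpos : 0 < j.val := by
    rw [Nat.pos_iff_ne_zero]
    intro h0
    apply hi
    rw [← Equiv.symm_apply_eq, ← hj]
    exact Fin.ext h0
  rw [spectralGap, sub_sub_cancel]
  exact le_ciSup (f := fun i : {i : Fin (Fintype.card V) // 0 < i.val} =>
    |(transitionMatrix_isHermitian G d s).eigenvalues₀ i.1|)
    (Set.finite_range _).bddAbove ⟨j, hpos⟩

theorem sum_walkCoord_mul (f g : V → ℝ) :
    ∑ i, walkCoord G d s i f * walkCoord G d s i g = f ⬝ᵥ g := sum_eigencoord_mul _ f g

theorem sum_walkCoord_sq (f : V → ℝ) : ∑ i, walkCoord G d s i f ^ 2 = f ⬝ᵥ f :=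
  sum_eigencoord_sq _ f

theorem walkCoord_sub (i : V) (f g : V → ℝ) :
    walkCoord G d s i (f - g) = walkCoord G d s i f - walkCoord G d s i g := eigencoord_sub _ i f g

theorem walkCoord_walkOp (i : V) (f : V → ℝ) :
    walkCoord G d s i (walkOp G d s f) = walkEig G d s i * walkCoord G d s i f :=
  eigencoord_mulVec _ i f

theorem walkCoord_walkOp_pow (k : ℕ) (i : V) (f : V → ℝ) :
    walkCoord G d s i ((walkOp G d s ^ k) f) = walkEig G d s i ^ k * walkCoord G d s i f := by
  induction k with
  | zero => simp
  | succ k ih =>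
    rw [pow_succ', mul_apply_eq_comp, walkCoord_walkOp, ih]; ring

theorem dotProduct_walkOp_pow_comm (k : ℕ) (f g : V → ℝ) :
    (walkOp G d s ^ k) f ⬝ᵥ g = f ⬝ᵥ (walkOp G d s ^ k) g := by
  rw [← sum_walkCoord_mul G d s,
    ← sum_walkCoord_mul G d s]
  refine Finset.sum_congr rfl fun i _ => ?_
  rw [walkCoord_walkOp_pow, walkCoord_walkOp_pow]; ring

variable {G d s} (hG : G.IsRegularOfDegree d) (hD : 0 < d + s)

omit [DecidableEq V] in
include hG in
theorem abs_sum_neighborFinset_le (f : V → ℝ) (u : V) :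
    |∑ v ∈ G.neighborFinset u, f v| ≤ d * ‖f‖ := by
  calc _ ≤ ∑ v ∈ G.neighborFinset u, |f v| := Finset.abs_sum_le_sum_abs _ _
    _ ≤ ∑ v ∈ G.neighborFinset u, ‖f‖ := Finset.sum_le_sum fun v _ => norm_le_pi_norm f v
    _ = _ := by rw [Finset.sum_const, G.card_neighborFinset_eq_degree, hG u, nsmul_eq_mul]

include hG hD in
theorem walkOp_const (a : ℝ) : walkOp G d s (fun _ => a) = fun _ => a := by
  ext u
  have : (0 : ℝ) < ((d + s : ℕ) : ℝ) := by exact_mod_cast hD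
  rw [walkOp_apply, Finset.sum_const, G.card_neighborFinset_eq_degree, hG u, nsmul_eq_mul,
    div_eq_iff this.ne']
  push_cast; ring

include hG hD in
theorem norm_walkOp_apply_le (f : V → ℝ) : ‖walkOp G d s f‖ ≤ ‖f‖ := by
  have hD' : (0 : ℝ) < ((d + s : ℕ) : ℝ) := by exact_mod_cast hD
  refine (pi_norm_le_iff_of_nonneg (norm_nonneg _)).2 fun u => ?_
  rw [walkOp_apply, Real.norm_eq_abs, abs_div, abs_of_pos hD', div_le_iff₀ hD']
  calc _ ≤ |(s : ℝ) * f u| + |∑ v ∈ G.neighborFinset u, f v| := abs_add_le _ _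
    _ ≤ s * ‖f‖ + d * ‖f‖ := by
      rw [abs_mul, Nat.abs_cast]
      gcongr
      · exact norm_le_pi_norm f u
      · exact abs_sum_neighborFinset_le hG f u
    _ = _ := by push_cast; ring

include hG hD in
theorem norm_walkOp_le : ‖walkOp G d s‖ ≤ 1 :=
  ContinuousLinearMap.opNorm_le_bound _ zero_le_one fun f => by
    rw [one_mul]; exact norm_walkOp_apply_le hG hD f

include hG hD in
-- For `d ≤ s` the diagonal entry `(s - d) / (d + s)` of `2 * P - 1` is nonnegative, so this matrix
-- is again stochastic.
theorem norm_two_smul_walkOp_sub_le (hds : d ≤ s) (f : V → ℝ) :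
    ‖(2 : ℝ) • walkOp G d s f - f‖ ≤ ‖f‖ := by
  have hD' : (0 : ℝ) < ((d + s : ℕ) : ℝ) := by exact_mod_cast hD
  refine (pi_norm_le_iff_of_nonneg (norm_nonneg _)).2 fun u => ?_
  have e : ((2 : ℝ) • walkOp G d s f - f) u =
      ((s - d) * f u + 2 * ∑ v ∈ G.neighborFinset u, f v) / ((d + s : ℕ) : ℝ) := by
    rw [Pi.sub_apply, Pi.smul_apply, walkOp_apply, smul_eq_mul, eq_div_iff hD'.ne', sub_mul,
      mul_assoc, div_mul_cancel₀ _ hD'.ne']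
    push_cast; ring
  have hds' : (0 : ℝ) ≤ s - d := sub_nonneg.2 (by exact_mod_cast hds)
  rw [e, Real.norm_eq_abs, abs_div, abs_of_pos hD', div_le_iff₀ hD']
  calc _ ≤ |((s : ℝ) - d) * f u| + |2 * ∑ v ∈ G.neighborFinset u, f v| := abs_add_le _ _
    _ ≤ (s - d) * ‖f‖ + 2 * (d * ‖f‖) := by
      rw [abs_mul, abs_mul, abs_of_nonneg hds', abs_two]
      gcongr
      · exact norm_le_pi_norm f u
      · exact abs_sum_neighborFinset_le hG f u
    _ = _ := by push_cast; ring

include hG hD in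
theorem norm_two_mul_walkOp_sub_one_le (hds : d ≤ s) : ‖2 * walkOp G d s - 1‖ ≤ 1 :=
  ContinuousLinearMap.opNorm_le_bound _ zero_le_one fun f => by
    have e : (2 * walkOp G d s - 1) f = (2 : ℝ) • walkOp G d s f - f := by
      rw [two_mul, two_smul]; rfl
    rw [one_mul, e]
    exact norm_two_smul_walkOp_sub_le hG hD hds f

include hG hD in
theorem walkEig_le_one (i : V) : walkEig G d s i ≤ 1 := by
  have := abs_affine_eigenvalue_le (transitionMatrix_isHermitian G d s) 1 0
    (fun f => by simpa using! norm_walkOp_apply_le hG hD f) i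
  rw [one_mul, sub_zero] at this
  exact (le_abs_self _).trans this

include hG hD in
theorem walkEig_nonneg (hds : d ≤ s) (i : V) : 0 ≤ walkEig G d s i := by
  have := abs_affine_eigenvalue_le (transitionMatrix_isHermitian G d s) 2 1
    (fun f => by rw [one_smul]; exact norm_two_smul_walkOp_sub_le hG hD hds f) i
  have := (abs_le.1 this).1
  change 0 ≤ (transitionMatrix_isHermitian G d s).eigenvalues i
  linarith

include hG hD in
theorem walkOp_pow_const (k : ℕ) (a : ℝ) : (walkOp G d s ^ k) (fun _ => a) = fun _ => a := by
  induction k with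
  | zero => simp
  | succ k ih => rw [pow_succ, mul_apply_eq_comp, walkOp_const hG hD, ih]

include hG hD in
/-- The walk contracts functions of mean zero. -/
theorem walkOp_pow_dotProduct_self_le [Nonempty V] (hμ : 0 < spectralGap G d s) {f : V → ℝ}
    (hf : ∑ v, f v = 0) (k : ℕ) :
    (walkOp G d s ^ k) f ⬝ᵥ (walkOp G d s ^ k) f ≤
      ((1 - spectralGap G d s) ^ k) ^ 2 * (f ⬝ᵥ f) := by
  obtain ⟨i₀, hi₀⟩ := exists_abs_walkEig_le G d s
  -- Constants are fixed, and all eigenvalues other than that of `i₀` are below 1; hence constants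
  -- lie on the `i₀`-th eigenline, and a function of mean zero has no component there.
  have h1 : ∀ i, i ≠ i₀ → walkCoord G d s i (fun _ => 1) = 0 := by
    intro i hi
    have h := walkCoord_walkOp G d s i (fun _ => 1)
    rw [walkOp_const hG hD] at h
    have hlt : walkEig G d s i < 1 := (le_abs_self _).trans_lt ((hi₀ i hi).trans_lt (by linarith))
    have : (1 - walkEig G d s i) * walkCoord G d s i (fun _ => 1) = 0 := by linarith
    exact (mul_eq_zero.1 this).resolve_left (by linarith)
  have h2 : ∀ g : V → ℝ,
      g ⬝ᵥ (fun _ => 1) = walkCoord G d s i₀ g * walkCoord G d s i₀ (fun _ => 1) := by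
    intro g
    rw [← sum_walkCoord_mul G d s]
    exact Finset.sum_eq_single_of_mem i₀ (Finset.mem_univ _) fun i _ hi => by rw [h1 i hi, mul_zero]
  have h3 : walkCoord G d s i₀ f = 0 := by
    have hf' := h2 f
    have hone := h2 (fun _ => 1)
    simp only [dotProduct, mul_one, hf, Finset.sum_const, Finset.card_univ, nsmul_eq_mul] at hf' hone
    refine (mul_eq_zero.1 hf'.symm).resolve_right fun h0 => ?_
    rw [h0, mul_zero] at hone
    exact Fintype.card_ne_zero (by exact_mod_cast hone)
  rw [← sum_walkCoord_sq G d s,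
    ← sum_walkCoord_sq G d s, Finset.mul_sum]
  refine Finset.sum_le_sum fun i _ => ?_
  rw [walkCoord_walkOp_pow, mul_pow]
  rcases eq_or_ne i i₀ with rfl | hi
  · simp [h3]
  · gcongr ?_ * _
    rw [← sq_abs, abs_pow]
    gcongr
    exact hi₀ i hi

include hG hD in
/-- A set of nodes that no edge leaves is trivial. -/
theorem exists_adj_of_spectralGap_pos [Nonempty V] (hμ : 0 < spectralGap G d s) (S : V → Prop)
    {a b : V} (ha : S a) (hb : ¬ S b) : ∃ u v, S u ∧ ¬ S v ∧ G.Adj u v := by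
  classical
  by_contra! hno
  have hD' : (0 : ℝ) < ((d + s : ℕ) : ℝ) := by exact_mod_cast hD
  -- If no edge left `S`, its centred indicator would be a nonzero fixed function of mean zero,
  -- against the strict contraction.
  have hfix : ∀ c : ℝ, walkOp G d s (fun v => (if S v then 1 else 0) - c) =
      fun v => (if S v then 1 else 0) - c := by
    intro c
    ext u
    have : ∀ v ∈ G.neighborFinset u, ((if S v then (1 : ℝ) else 0) - c) =
        (if S u then 1 else 0) - c := by
      intro v hv
      rw [SimpleGraph.mem_neighborFinset] at hv
      by_cases hu : S u <;> by_cases hv' : S v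
      · simp [hu, hv']
      · exact absurd hv (hno u v hu hv')
      · exact absurd hv.symm (hno v u hv' hu)
      · simp [hu, hv']
    rw [walkOp_apply, Finset.sum_congr rfl this, Finset.sum_const,
      G.card_neighborFinset_eq_degree, hG u, nsmul_eq_mul, div_eq_iff hD'.ne']
    push_cast; ring
  set c : ℝ := (∑ v, if S v then (1 : ℝ) else 0) / Fintype.card V with hc
  set f : V → ℝ := fun v => (if S v then 1 else 0) - c with hf
  have hn : (Fintype.card V : ℝ) ≠ 0 := by exact_mod_cast Fintype.card_ne_zero
  have hsum : ∑ v, f v = 0 := by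
    rw [hf, Finset.sum_sub_distrib, Finset.sum_const, Finset.card_univ, nsmul_eq_mul, hc,
      mul_div_cancel₀ _ hn, sub_self]
  have h := walkOp_pow_dotProduct_self_le hG hD hμ hsum 1
  rw [pow_one, pow_one, hfix c] at h
  have hle := spectralGap_le_one G d s
  have hff : f ⬝ᵥ f ≤ 0 := by
    have h0 : 0 ≤ f ⬝ᵥ f := Finset.sum_nonneg fun v _ => mul_self_nonneg _
    have h2 : (1 - spectralGap G d s) ^ 2 < 1 := by
      rw [sq_lt_one_iff₀ (by linarith)]; linarith
    nlinarith
  have hf0 : ∀ v, f v = 0 := by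
    intro v
    have := (Finset.sum_eq_zero_iff_of_nonneg (fun v _ => mul_self_nonneg (f v))).1
      (le_antisymm hff (Finset.sum_nonneg fun v _ => mul_self_nonneg _)) v (Finset.mem_univ v)
    exact mul_self_eq_zero.1 this
  have h1 := hf0 a
  have h2 := hf0 b
  simp only [hf, if_pos ha, if_neg hb] at h1 h2
  linarith

end Walk


open Matrix MeasureTheory

/-! ### Euclidean norm, supremum norm and mean. -/

section Norms

variable {V : Type*} [Fintype V]

theorem dotProduct_self_nonneg' (f : V → ℝ) : 0 ≤ f ⬝ᵥ f :=
  Finset.sum_nonneg fun _ _ => mul_self_nonneg _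

theorem norm_le_sqrt_dotProduct_self (f : V → ℝ) : ‖f‖ ≤ √(f ⬝ᵥ f) := by
  refine (pi_norm_le_iff_of_nonneg (Real.sqrt_nonneg _)).2 fun u => ?_
  rw [Real.norm_eq_abs]
  refine Real.abs_le_sqrt ?_
  rw [sq]
  exact Finset.single_le_sum (f := fun v => f v * f v) (fun v _ => mul_self_nonneg _)
    (Finset.mem_univ u)

theorem sqrt_dotProduct_self_le (f : V → ℝ) : √(f ⬝ᵥ f) ≤ √(Fintype.card V) * ‖f‖ := by
  refine Real.sqrt_le_iff.2 ⟨by positivity, ?_⟩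
  rw [mul_pow, Real.sq_sqrt (Nat.cast_nonneg _)]
  calc f ⬝ᵥ f ≤ ∑ _v : V, ‖f‖ ^ 2 := Finset.sum_le_sum fun v _ => by
        rw [← sq, ← sq_abs, ← Real.norm_eq_abs]
        exact pow_le_pow_left₀ (norm_nonneg _) (norm_le_pi_norm f v) 2
    _ = _ := by rw [Finset.sum_const, Finset.card_univ, nsmul_eq_mul]

theorem abs_dotProduct_le_sqrt_mul_sqrt (f g : V → ℝ) : |f ⬝ᵥ g| ≤ √(f ⬝ᵥ f) * √(g ⬝ᵥ g) := by
  rw [← Real.sqrt_mul (dotProduct_self_nonneg' f)]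
  refine Real.abs_le_sqrt ?_
  simpa only [dotProduct, sq] using Finset.sum_mul_sq_le_sq_mul_sq Finset.univ f g

/-- The mean of a function. -/
noncomputable def mean (f : V → ℝ) : ℝ := (∑ v, f v) / Fintype.card V

theorem sum_sub_mean [Nonempty V] (f : V → ℝ) : ∑ v, (f - fun _ => mean f : V → ℝ) v = 0 := by
  have hn : (Fintype.card V : ℝ) ≠ 0 := by exact_mod_cast Fintype.card_ne_zero
  simp only [Pi.sub_apply]
  rw [Finset.sum_sub_distrib, Finset.sum_const, Finset.card_univ, nsmul_eq_mul, mean,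
    mul_div_cancel₀ _ hn, sub_self]

theorem dotProduct_sub_mean_le [Nonempty V] (f : V → ℝ) :
    (f - fun _ => mean f) ⬝ᵥ (f - fun _ => mean f) ≤ f ⬝ᵥ f := by
  have h := sum_sub_mean f
  have e : f ⬝ᵥ f = (f - fun _ => mean f) ⬝ᵥ (f - fun _ => mean f) +
      (2 * mean f * ∑ v, (f - fun _ => mean f : V → ℝ) v + ∑ _v : V, mean f ^ 2) := by
    simp only [dotProduct, Finset.mul_sum, ← Finset.sum_add_distrib, Pi.sub_apply]
    exact Finset.sum_congr rfl fun v _ => by ring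
  rw [e, h, mul_zero, zero_add]
  exact le_add_of_nonneg_right (Finset.sum_nonneg fun _ _ => sq_nonneg _)

end Norms

/-! ### Mixing in the supremum norm. -/

section Contraction

variable {V : Type*} [Fintype V] [DecidableEq V] [Nonempty V] {G : SimpleGraph V}
  [DecidableRel G.Adj] {d s : ℕ} (hG : G.IsRegularOfDegree d) (hD : 0 < d + s)

include hG hD

/-- The contraction is Euclidean; bounding the Euclidean norm of `f` by its supremum norm costs the
factor `√n`. -/
theorem norm_walkOp_pow_sub_mean_le (hμ : 0 < spectralGap G d s) (f : V → ℝ) (k : ℕ) :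
    ‖(walkOp G d s ^ k) (f - fun _ => mean f)‖ ≤
      (1 - spectralGap G d s) ^ k * √(Fintype.card V) * ‖f‖ := by
  have hle := spectralGap_le_one G d s
  calc _ ≤ _ := norm_le_sqrt_dotProduct_self _
    _ ≤ √(((1 - spectralGap G d s) ^ k) ^ 2 * (f ⬝ᵥ f)) := by
      refine Real.sqrt_le_sqrt ((walkOp_pow_dotProduct_self_le hG hD hμ (sum_sub_mean f) k).trans ?_)
      gcongr
      exact dotProduct_sub_mean_le f
    _ = (1 - spectralGap G d s) ^ k * √(f ⬝ᵥ f) := by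
      rw [Real.sqrt_mul (sq_nonneg _), Real.sqrt_sq (pow_nonneg (by linarith) _)]
    _ ≤ _ := by
      rw [mul_assoc]
      exact mul_le_mul_of_nonneg_left (sqrt_dotProduct_self_le f) (pow_nonneg (by linarith) _)

omit [Nonempty V] in
theorem walkOp_pow_mul_one_sub_const (k : ℕ) (a : ℝ) :
    (walkOp G d s ^ k * (1 - walkOp G d s)) (fun _ => a) = 0 := by
  rw [mul_apply_eq_comp, _root_.sub_apply, walkOp_const hG hD]
  simp

/-- `T ^ k * (1 - T)` kills constants, so the argument may be centred before the first `m` steps act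
on it. -/
theorem norm_walkOp_pow_mul_one_sub_halving (hμ : 0 < spectralGap G d s) {m : ℕ}
    (hm : (1 - spectralGap G d s) ^ m * √(Fintype.card V) ≤ 1 / 2) (k : ℕ) :
    ‖walkOp G d s ^ (m + k) * (1 - walkOp G d s)‖ ≤
      ‖walkOp G d s ^ k * (1 - walkOp G d s)‖ / 2 := by
  set T := walkOp G d s
  refine ContinuousLinearMap.opNorm_le_bound _ (by positivity) fun f => ?_
  have e : (T ^ (m + k) * (1 - T)) f =
      (T ^ k * (1 - T)) ((T ^ m) (f - fun _ => mean f)) := by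
    have hc : T ^ (m + k) * (1 - T) = T ^ k * (1 - T) * T ^ m := by
      have : Commute (1 - T) (T ^ m) := (Commute.one_left _).sub_left (Commute.self_pow T m)
      rw [mul_assoc, this.eq, ← mul_assoc, ← pow_add, add_comm]
    rw [map_sub, map_sub, walkOp_pow_const hG hD, walkOp_pow_mul_one_sub_const hG hD, sub_zero, hc]
    rfl
  rw [e]
  calc _ ≤ ‖T ^ k * (1 - T)‖ * ‖(T ^ m) (f - fun _ => mean f)‖ :=
        ContinuousLinearMap.le_opNorm _ _
    _ ≤ ‖T ^ k * (1 - T)‖ * (1 / 2 * ‖f‖) := by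
        gcongr
        exact (norm_walkOp_pow_sub_mean_le hG hD hμ f m).trans (by gcongr)
    _ = _ := by ring

end Contraction

/-! ### Nash-type decay of the lazy walk, independent of the gap. -/

section Decay

variable {V : Type*} [Fintype V] [DecidableEq V] {G : SimpleGraph V} [DecidableRel G.Adj]

omit [DecidableEq V] in
/-- If no nontrivial set is left by no edge, the range of a function is covered by its descents
along edges. -/
theorem sub_le_sum_descent
    (hconn : ∀ (S : V → Prop) {a b : V}, S a → ¬ S b → ∃ u v, S u ∧ ¬ S v ∧ G.Adj u v)
    (g : V → ℝ) (a : V) {b : V} {m : ℝ} (hb : g b ≤ m) :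
    g a - m ≤ ∑ u with m < g u, √(∑ v, if G.Adj u v then (max (g u - g v) 0) ^ 2 else 0) := by
  set drop : V → ℝ := fun u => √(∑ v, if G.Adj u v then (max (g u - g v) 0) ^ 2 else 0) with hdrop
  have hdrop0 : ∀ u, 0 ≤ drop u := fun u => Real.sqrt_nonneg _
  have hle : ∀ u v, G.Adj u v → g u - g v ≤ drop u := by
    intro u v huv
    refine (le_max_left _ 0).trans (Real.le_sqrt_of_sq_le ?_)
    have := Finset.single_le_sum
      (f := fun v => if G.Adj u v then (max (g u - g v) 0) ^ 2 else 0)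
      (fun v _ => by positivity) (Finset.mem_univ v)
    simpa [huv] using this
  -- For each level `τ` in the interval, some edge leaves the superlevel set of `τ`, so the descent
  -- along it passes `τ`. Comparing lengths gives the claim.
  have hcover : Set.Ioc m (g a) ⊆ ⋃ u ∈ Finset.univ.filter (fun u => m < g u),
      Set.Icc (g u - drop u) (g u) := by
    intro τ hτ
    obtain ⟨u, v, hu, hv, huv⟩ := hconn (fun w => τ ≤ g w) hτ.2 (b := b)
      (not_le.2 (hb.trans_lt hτ.1))
    simp only [Set.mem_iUnion, Finset.mem_filter, Finset.mem_univ, true_and]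
    exact ⟨u, hτ.1.trans_le hu, by linarith [hle u v huv], hu⟩
  have hvol := (measure_mono hcover).trans
    (measure_biUnion_finset_le (μ := (volume : Measure ℝ)) _ _)
  simp only [Real.volume_Ioc, Real.volume_Icc, sub_sub_cancel] at hvol
  rw [← ENNReal.ofReal_sum_of_nonneg fun u _ => hdrop0 u] at hvol
  exact (ENNReal.ofReal_le_ofReal_iff (Finset.sum_nonneg fun u _ => hdrop0 u)).1 hvol

omit [DecidableEq V] in
/-- A Nash-type inequality: the energy of a probability density bounds the cube of its variance. -/
theorem cube_variance_le_energy [Nonempty V]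
    (hconn : ∀ (S : V → Prop) {a b : V}, S a → ¬ S b → ∃ u v, S u ∧ ¬ S v ∧ G.Adj u v)
    {g : V → ℝ} (hg0 : ∀ v, 0 ≤ g v) (hg1 : ∑ v, g v = 1) :
    ((g - fun _ => mean g) ⬝ᵥ (g - fun _ => mean g)) ^ 3 / 8 ≤
      ∑ u, ∑ v, if G.Adj u v then (max (g u - g v) 0) ^ 2 else 0 := by
  set A := (g - fun _ => mean g) ⬝ᵥ (g - fun _ => mean g) with hA
  set E : V → ℝ := fun u => ∑ v, if G.Adj u v then (max (g u - g v) 0) ^ 2 else 0 with hE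
  have hE0 : ∀ u, 0 ≤ E u := fun u => Finset.sum_nonneg fun v _ => by positivity
  have hA0 : 0 ≤ A := dotProduct_self_nonneg' _
  have hm0 : 0 ≤ mean g := div_nonneg (Finset.sum_nonneg fun v _ => hg0 v) (Nat.cast_nonneg _)
  rcases hA0.eq_or_lt with h | hApos
  · rw [← h]; simpa using Finset.sum_nonneg fun u _ => hE0 u
  obtain ⟨a, -, ha⟩ := Finset.exists_max_image Finset.univ g Finset.univ_nonempty
  obtain ⟨b, -, hb⟩ := Finset.exists_min_image Finset.univ g Finset.univ_nonempty
  have hsum := sum_sub_mean g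
  have hbm : g b ≤ mean g := by
    by_contra! hlt
    have : 0 < ∑ v, (g - fun _ => mean g : V → ℝ) v :=
      Finset.sum_pos (fun v hv => sub_pos.2 (hlt.trans_le (hb v hv))) Finset.univ_nonempty
    linarith
  have hAa : A ≤ g a - mean g := by
    have e : A = ∑ v, g v * (g v - mean g) - mean g * ∑ v, (g - fun _ => mean g : V → ℝ) v := by
      rw [hA, Finset.mul_sum, ← Finset.sum_sub_distrib]
      exact Finset.sum_congr rfl fun v _ => by simp only [Pi.sub_apply]; ring
    rw [e, hsum, mul_zero, sub_zero]
    calc _ ≤ ∑ v, g v * (g a - mean g) := Finset.sum_le_sum fun v hv =>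
          mul_le_mul_of_nonneg_left (by linarith [ha v hv]) (hg0 v)
      _ = _ := by rw [← Finset.sum_mul, hg1, one_mul]
  -- The level lies `A / 2` above the mean: the maximum exceeds it by at least `A / 2`, while at
  -- most `2 / A` nodes lie above it because `g` has total mass 1. Cauchy–Schwarz over these nodes
  -- gives the cube.
  have hdesc := sub_le_sum_descent hconn g a (b := b) (m := mean g + A / 2) (by linarith)
  set U := Finset.univ.filter (fun u => mean g + A / 2 < g u) with hU
  have hcard : (U.card : ℝ) * (A / 2) ≤ 1 := by
    calc (U.card : ℝ) * (A / 2) = ∑ _u ∈ U, A / 2 := by rw [Finset.sum_const, nsmul_eq_mul]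
      _ ≤ ∑ u ∈ U, g u := Finset.sum_le_sum fun u hu => by
          have := (Finset.mem_filter.1 hu).2; linarith
      _ ≤ ∑ u, g u := Finset.sum_le_sum_of_subset_of_nonneg (Finset.subset_univ _)
          fun u _ _ => hg0 u
      _ = 1 := hg1
  have hsq : (A / 2) ^ 2 ≤ U.card * ∑ u, E u := by
    calc (A / 2) ^ 2 ≤ (∑ u ∈ U, √(E u)) ^ 2 := by
          apply pow_le_pow_left₀ (by linarith)
          linarith
      _ ≤ U.card * ∑ u ∈ U, √(E u) ^ 2 := sq_sum_le_card_mul_sum_sq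
      _ ≤ U.card * ∑ u, E u := by
          gcongr
          rw [Finset.sum_congr rfl fun u _ => Real.sq_sqrt (hE0 u)]
          exact Finset.sum_le_sum_of_subset_of_nonneg (Finset.subset_univ _) fun u _ _ => hE0 u
  calc A ^ 3 / 8 = (A / 2) ^ 2 * (A / 2) := by ring
    _ ≤ U.card * (∑ u, E u) * (A / 2) := by gcongr
    _ = (U.card * (A / 2)) * ∑ u, E u := by ring
    _ ≤ 1 * ∑ u, E u := by gcongr
    _ = _ := one_mul _

variable {d s : ℕ} (hG : G.IsRegularOfDegree d) (hD : 0 < d + s)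

include hG hD

/-- The Dirichlet form: the positive part makes each edge count once, and self-loops contribute
nothing. -/
theorem energy_eq (h : V → ℝ) :
    ∑ u, ∑ v, (if G.Adj u v then (max (h u - h v) 0) ^ 2 else 0) =
      ((d + s : ℕ) : ℝ) * (h ⬝ᵥ (h - walkOp G d s h)) := by
  have hD' : (((d + s : ℕ) : ℝ)) ≠ 0 := by exact_mod_cast hD.ne'
  have hdeg : ∀ u (c : ℝ), ∑ v, (if G.Adj u v then c else 0) = d * c := by
    intro u c
    rw [← Finset.sum_filter, ← SimpleGraph.neighborFinset_eq_filter, Finset.sum_const,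
      G.card_neighborFinset_eq_degree, hG u, nsmul_eq_mul]
  have hrhs : ((d + s : ℕ) : ℝ) * (h ⬝ᵥ (h - walkOp G d s h)) =
      ∑ u, ∑ v, if G.Adj u v then h u * (h u - h v) else 0 := by
    rw [dotProduct, Finset.mul_sum]
    refine Finset.sum_congr rfl fun u _ => ?_
    have e : ∑ v, (if G.Adj u v then h u * (h u - h v) else 0) =
        ∑ v, (if G.Adj u v then h u * h u else 0) - h u * ∑ v ∈ G.neighborFinset u, h v := by
      rw [SimpleGraph.neighborFinset_eq_filter, Finset.sum_filter, Finset.mul_sum,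
        ← Finset.sum_sub_distrib]
      refine Finset.sum_congr rfl fun v _ => ?_
      split_ifs <;> ring
    rw [e, hdeg, Pi.sub_apply, walkOp_apply]
    field_simp
    push_cast; ring
  have hswap : ∀ F : V → V → ℝ, ∑ u, ∑ v, (if G.Adj u v then F u v else 0) =
      ∑ u, ∑ v, (if G.Adj u v then F v u else 0) := by
    intro F
    rw [Finset.sum_comm]
    simp only [G.adj_comm]
  have h1 := hswap fun u v => (max (h u - h v) 0) ^ 2
  have h2 := hswap fun u v => h u * (h u - h v)
  have h3 : ∑ u, ∑ v, (if G.Adj u v then (max (h u - h v) 0) ^ 2 else 0) +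
      ∑ u, ∑ v, (if G.Adj u v then (max (h v - h u) 0) ^ 2 else 0) =
      ∑ u, ∑ v, (if G.Adj u v then h u * (h u - h v) else 0) +
      ∑ u, ∑ v, (if G.Adj u v then h v * (h v - h u) else 0) := by
    simp only [← Finset.sum_add_distrib]
    refine Finset.sum_congr rfl fun u _ => Finset.sum_congr rfl fun v _ => ?_
    split_ifs
    · rcases le_total (h u) (h v) with hle | hle
      · rw [max_eq_right (by linarith), max_eq_left (by linarith)]; ring
      · rw [max_eq_left (by linarith), max_eq_right (by linarith)]; ring
    · rfl
  rw [hrhs]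
  linarith

/-- Laziness puts the eigenvalues in `[0, 1]`, where `1 - λ ≤ 1 - λ ^ 2`. Thus the energy bounds
from below the loss of squared norm in one step. -/
theorem dotProduct_sub_walkOp_le (hds : d ≤ s) (h : V → ℝ) :
    h ⬝ᵥ (h - walkOp G d s h) ≤ h ⬝ᵥ h - walkOp G d s h ⬝ᵥ walkOp G d s h := by
  rw [← sum_walkCoord_mul G d s, ← sum_walkCoord_mul G d s, ← sum_walkCoord_mul G d s,
    ← Finset.sum_sub_distrib]
  refine Finset.sum_le_sum fun i _ => ?_
  rw [walkCoord_sub, walkCoord_walkOp]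
  have h0 := walkEig_nonneg hG hD hds i
  have h1 := walkEig_le_one hG hD i
  nlinarith [mul_nonneg (mul_nonneg h0 (sub_nonneg.2 h1)) (sq_nonneg (walkCoord G d s i h))]

omit [DecidableEq V] hG hD in
theorem mean_eq_of_sum_eq {f g : V → ℝ} (h : ∑ v, f v = ∑ v, g v) : mean f = mean g := by
  rw [mean, mean, h]

theorem sum_walkOp_pow (k : ℕ) (f : V → ℝ) : ∑ v, (walkOp G d s ^ k) f v = ∑ v, f v := by
  have h := dotProduct_walkOp_pow_comm G d s k f (fun _ => 1)
  rw [walkOp_pow_const hG hD] at h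
  simpa [dotProduct] using h

omit hG hD in
theorem walkOp_pow_nonneg (k : ℕ) {f : V → ℝ} (hf : ∀ v, 0 ≤ f v) (v : V) :
    0 ≤ (walkOp G d s ^ k) f v := by
  induction k generalizing v with
  | zero => simpa using hf v
  | succ k ih =>
    rw [pow_succ', mul_apply_eq_comp, walkOp_apply]
    have := Finset.sum_nonneg fun w (_ : w ∈ G.neighborFinset v) => ih w
    have := ih v
    positivity

/-- The variance of the distribution of the walk after `k` steps decays like `√((d + s) / k)`. -/
theorem variance_walkOp_pow_single_sq_le [Nonempty V] (hμ : 0 < spectralGap G d s) (hds : d ≤ s)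
    (u : V) (k : ℕ) :
    ((walkOp G d s ^ k) (Pi.single u 1 - fun _ => mean (Pi.single u 1)) ⬝ᵥ
      (walkOp G d s ^ k) (Pi.single u 1 - fun _ => mean (Pi.single u 1))) ^ 2 * k ≤
      4 * ((d + s : ℕ) : ℝ) := by
  have hD' : 0 < ((d + s : ℕ) : ℝ) := by exact_mod_cast hD
  set e : V → ℝ := Pi.single u 1 with he
  have he0 : ∀ v, 0 ≤ e v := fun v => by
    rw [he, Pi.single_apply]; split_ifs <;> norm_num
  have he1 : ∑ v, e v = 1 := by simp [he]
  set a : ℕ → ℝ := fun k => (walkOp G d s ^ k) (e - fun _ => mean e) ⬝ᵥ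
      (walkOp G d s ^ k) (e - fun _ => mean e) with ha
  -- The variance satisfies `a k ^ 3 / 8 ≤ energy ≤ (d + s) * (a k - a (k + 1))`, whence `κ`.
  have key := sq_mul_le_of_cubic_decrease (a := a) (κ := 1 / (8 * ((d + s : ℕ) : ℝ)))
    (by positivity) (fun k => dotProduct_self_nonneg' _) (fun k => by
      have hg0 := walkOp_pow_nonneg (G := G) (d := d) (s := s) k he0
      have hg1 := (sum_walkOp_pow hG hD k e).trans he1
      have hcube := cube_variance_le_energy
        (fun S a b => exists_adj_of_spectralGap_pos hG hD hμ S) hg0 hg1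
      have hstep : (walkOp G d s ^ k) e - (fun _ => mean ((walkOp G d s ^ k) e)) =
          (walkOp G d s ^ k) (e - fun _ => mean e) := by
        rw [map_sub, walkOp_pow_const hG hD, mean_eq_of_sum_eq (sum_walkOp_pow hG hD k e)]
      have hE : ∀ c : ℝ, ∑ u, ∑ v, (if G.Adj u v then
          (max ((walkOp G d s ^ k) e u - (walkOp G d s ^ k) e v) 0) ^ 2 else 0) =
          ∑ u, ∑ v, (if G.Adj u v then (max (((walkOp G d s ^ k) e - fun _ => c : V → ℝ) u -
            ((walkOp G d s ^ k) e - fun _ => c : V → ℝ) v) 0) ^ 2 else 0) := by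
        intro c; simp only [Pi.sub_apply, sub_sub_sub_cancel_right]
      rw [hE (mean ((walkOp G d s ^ k) e)), hstep, energy_eq hG hD] at hcube
      have hdec := dotProduct_sub_walkOp_le hG hD hds
        ((walkOp G d s ^ k) (e - fun _ => mean e))
      have hsucc : walkOp G d s ((walkOp G d s ^ k) (e - fun _ => mean e)) =
          (walkOp G d s ^ (k + 1)) (e - fun _ => mean e) := by
        rw [pow_succ']; rfl
      rw [hsucc] at hdec hcube
      have := mul_le_mul_of_nonneg_left hdec hD'.le
      rw [div_mul_eq_mul_div, one_mul, div_le_iff₀ (by positivity)]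
      simp only [ha]
      linarith) k
  have e2 : a k ^ 2 * (2 * (1 / (8 * ((d + s : ℕ) : ℝ))) * k) =
      a k ^ 2 * k / (4 * ((d + s : ℕ) : ℝ)) := by
    field_simp; ring
  rw [e2, div_le_one (by positivity)] at key
  exact key

omit hG hD [DecidableEq V] [Fintype V] [DecidableRel G.Adj] in
theorem mul_pow_mul_one_sub_le_one {x : ℝ} (h0 : 0 ≤ x) (h1 : x ≤ 1) (j : ℕ) :
    j * (x ^ j * (1 - x)) ≤ 1 := by
  have h : (∑ i ∈ Finset.range j, x ^ i) * (1 - x) = 1 - x ^ j := by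
    have := geom_sum_mul x j; linarith
  have h2 : (j : ℝ) * x ^ j ≤ ∑ i ∈ Finset.range j, x ^ i := by
    calc (j : ℝ) * x ^ j = ∑ i ∈ Finset.range j, x ^ j := by
          rw [Finset.sum_const, Finset.card_range, nsmul_eq_mul]
      _ ≤ _ := Finset.sum_le_sum fun i hi =>
          pow_le_pow_of_le_one h0 h1 (Finset.mem_range.1 hi).le
  have := mul_le_mul_of_nonneg_right h2 (sub_nonneg.2 h1)
  have := pow_nonneg h0 j
  nlinarith

theorem sqrt_dotProduct_walkOp_pow_mul_one_sub_le (hds : d ≤ s) {j : ℕ} (hj : 0 < j) (g : V → ℝ) :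
    √((walkOp G d s ^ j * (1 - walkOp G d s)) g ⬝ᵥ (walkOp G d s ^ j * (1 - walkOp G d s)) g) ≤
      1 / j * √(g ⬝ᵥ g) := by
  have hj' : (0 : ℝ) < j := by exact_mod_cast hj
  refine Real.sqrt_le_iff.2 ⟨by positivity, ?_⟩
  rw [mul_pow, Real.sq_sqrt (dotProduct_self_nonneg' _), ← sum_walkCoord_sq G d s,
    ← sum_walkCoord_sq G d s, Finset.mul_sum]
  refine Finset.sum_le_sum fun i _ => ?_
  have e : walkCoord G d s i ((walkOp G d s ^ j * (1 - walkOp G d s)) g) =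
      walkEig G d s i ^ j * (1 - walkEig G d s i) * walkCoord G d s i g := by
    have : (walkOp G d s ^ j * (1 - walkOp G d s)) g =
        (walkOp G d s ^ j) g - (walkOp G d s ^ (j + 1)) g := by
      rw [mul_sub, mul_one, ← pow_succ]; rfl
    rw [this, walkCoord_sub, walkCoord_walkOp_pow, walkCoord_walkOp_pow]; ring
  have h0 := walkEig_nonneg hG hD hds i
  have h1 := walkEig_le_one hG hD i
  rw [e, mul_pow]
  refine mul_le_mul_of_nonneg_right (pow_le_pow_left₀
    (mul_nonneg (pow_nonneg h0 _) (sub_nonneg.2 h1)) ?_ 2) (sq_nonneg _)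
  rw [le_div_iff₀ hj', mul_comm]
  exact mul_pow_mul_one_sub_le_one h0 h1 j

/-- Row `u` of the operator is `T ^ j * (1 - T)` applied to the centred law `g` of the walk from `u`
after `j` steps. The spectrum gives `1 / j`, the variance decay bounds `g`, and Cauchy–Schwarz
against `f` costs `√n`. -/
theorem norm_walkOp_pow_two_mul_mul_one_sub_le [Nonempty V] (hμ : 0 < spectralGap G d s)
    (hds : d ≤ s) {j : ℕ} (hj : 0 < j) :
    ‖walkOp G d s ^ (2 * j) * (1 - walkOp G d s)‖ ≤
      √(Fintype.card V) * (1 / j * √√(4 * ((d + s : ℕ) : ℝ) / j)) := by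
  have hj' : (0 : ℝ) < j := by exact_mod_cast hj
  set T := walkOp G d s
  refine ContinuousLinearMap.opNorm_le_bound _ (by positivity) fun f => ?_
  refine (pi_norm_le_iff_of_nonneg (by positivity)).2 fun u => ?_
  set e : V → ℝ := Pi.single u 1 with he
  set g := (T ^ j) (e - fun _ => mean e) with hg
  have hcomm : ∀ k : ℕ, ∀ f g : V → ℝ, (T ^ k * (1 - T)) f ⬝ᵥ g = f ⬝ᵥ (T ^ k * (1 - T)) g := by
    intro k f g
    have h : ∀ f, (T ^ k * (1 - T)) f = (T ^ k) f - (T ^ (k + 1)) f := by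
      intro f
      rw [mul_sub, mul_one, ← pow_succ]; rfl
    rw [h, h, sub_dotProduct, dotProduct_sub, dotProduct_walkOp_pow_comm,
      dotProduct_walkOp_pow_comm]
  have h1 : (T ^ (2 * j) * (1 - T)) f u = (T ^ j * (1 - T)) g ⬝ᵥ f := by
    have e1 : (T ^ j * (1 - T)) g = (T ^ (2 * j) * (1 - T)) e := by
      have hc : T ^ (2 * j) * (1 - T) = T ^ j * (1 - T) * T ^ j := by
        have : Commute (1 - T) (T ^ j) := (Commute.one_left _).sub_left (Commute.self_pow T j)
        rw [mul_assoc, this.eq, ← mul_assoc, ← pow_add, two_mul]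
      rw [hg, map_sub, map_sub, walkOp_pow_const hG hD, walkOp_pow_mul_one_sub_const hG hD,
        sub_zero, hc]
      rfl
    rw [e1, hcomm, he, single_one_dotProduct]
  rw [h1, Real.norm_eq_abs]
  have hA : √(g ⬝ᵥ g) ≤ √√(4 * ((d + s : ℕ) : ℝ) / j) := by
    apply Real.sqrt_le_sqrt
    apply Real.le_sqrt_of_sq_le
    rw [le_div_iff₀ hj']
    exact variance_walkOp_pow_single_sq_le hG hD hμ hds u j
  calc _ ≤ √((T ^ j * (1 - T)) g ⬝ᵥ (T ^ j * (1 - T)) g) * √(f ⬝ᵥ f) :=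
        abs_dotProduct_le_sqrt_mul_sqrt _ _
    _ ≤ (1 / j * √(g ⬝ᵥ g)) * (√(Fintype.card V) * ‖f‖) := by
        gcongr
        · exact sqrt_dotProduct_walkOp_pow_mul_one_sub_le hG hD hds hj g
        · exact sqrt_dotProduct_self_le f
    _ ≤ (1 / j * √√(4 * ((d + s : ℕ) : ℝ) / j)) * (√(Fintype.card V) * ‖f‖) := by gcongr
    _ = _ := by ring

theorem norm_walkOp_pow_mul_one_sub_le_of_two_le [Nonempty V] (hμ : 0 < spectralGap G d s)
    (hds : d ≤ s) {k : ℕ} (hk : 2 ≤ k) :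
    ‖walkOp G d s ^ k * (1 - walkOp G d s)‖ ≤
      6 * √(Fintype.card V) * √√((d + s : ℕ) : ℝ) * (1 / (k * √√(k : ℝ))) := by
  have hk' : (0 : ℝ) < k := by exact_mod_cast (by omega : 0 < k)
  -- Both `k = 2 * j` and `k = 2 * j + 1` satisfy `k ≤ 3 * j`. The 6 is `3 * 2`, with 2 a bound for
  -- the fourth root of `4 * 3`.
  have key : ∀ j : ℕ, 0 < j → (k : ℝ) ≤ 3 * j →
      √(Fintype.card V) * (1 / j * √√(4 * ((d + s : ℕ) : ℝ) / j)) ≤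
        6 * √(Fintype.card V) * √√((d + s : ℕ) : ℝ) * (1 / (k * √√(k : ℝ))) := by
    intro j hj hkj
    have hj' : (0 : ℝ) < j := by exact_mod_cast hj
    have h1 : (1 : ℝ) / j ≤ 3 / k := by
      rw [div_le_div_iff₀ hj' hk']; linarith
    have h2 : √√(4 * ((d + s : ℕ) : ℝ) / j) ≤ 2 * (√√((d + s : ℕ) : ℝ) / √√(k : ℝ)) := by
      have h16 : (2 : ℝ) = √√16 := by
        rw [show (16 : ℝ) = 4 ^ 2 by norm_num, Real.sqrt_sq (by norm_num),
          show (4 : ℝ) = 2 ^ 2 by norm_num, Real.sqrt_sq (by norm_num)]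
      rw [h16, ← Real.sqrt_div (Real.sqrt_nonneg _), ← Real.sqrt_div (Nat.cast_nonneg _),
        ← Real.sqrt_mul (Real.sqrt_nonneg _), ← Real.sqrt_mul (by norm_num)]
      refine Real.sqrt_le_sqrt (Real.sqrt_le_sqrt ?_)
      rw [mul_div_assoc', div_le_div_iff₀ hj' hk']
      have : (0 : ℝ) ≤ ((d + s : ℕ) : ℝ) := Nat.cast_nonneg _
      nlinarith
    calc _ ≤ √(Fintype.card V) * (3 / k * (2 * (√√((d + s : ℕ) : ℝ) / √√(k : ℝ)))) := by gcongr
      _ = _ := by field_simp; ring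
  obtain ⟨j, rfl | rfl⟩ := k.even_or_odd'
  · exact (norm_walkOp_pow_two_mul_mul_one_sub_le hG hD hμ hds (by omega)).trans
      (key j (by omega) (by push_cast; linarith [(Nat.cast_nonneg j : (0 : ℝ) ≤ j)]))
  · have hj : 0 < j := by omega
    have hj' : (1 : ℝ) ≤ j := by exact_mod_cast hj
    refine le_trans ?_ (key j hj (by push_cast; linarith))
    rw [pow_succ', mul_assoc]
    calc _ ≤ ‖walkOp G d s‖ * ‖walkOp G d s ^ (2 * j) * (1 - walkOp G d s)‖ := norm_mul_le _ _
      _ ≤ _ := (mul_le_of_le_one_left (norm_nonneg _) (norm_walkOp_le hG hD)).trans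
        (norm_walkOp_pow_two_mul_mul_one_sub_le hG hD hμ hds hj)

end Decay


/-! ### The perturbed linear recursion. -/

section Perturbation

variable {V : Type*} [Fintype V]

omit [Fintype V] in
/-- Abel summation for an inhomogeneous linear recursion. -/
theorem sub_sum_eq_of_recursion (T : (V → ℝ) →L[ℝ] (V → ℝ)) {x r η : ℕ → V → ℝ}
    (h : ∀ t, x (t + 1) = T (x t) + (r t - T (r t)) + η t) (t : ℕ) :
    x t - ∑ τ ∈ Finset.range t, η τ = (T ^ t) (x 0) +
      ∑ k ∈ Finset.range t, (T ^ k * (1 - T))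
        (r (t - 1 - k) - ∑ τ ∈ Finset.range (t - 1 - k), η τ) := by
  induction t with
  | zero => simp
  | succ t ih =>
    -- Subtracting the accumulated `η` from `x` leaves a recursion whose only inhomogeneity is `(1 -
    -- T) (w t)`.
    set w : ℕ → V → ℝ := fun t => r t - ∑ τ ∈ Finset.range t, η τ with hw
    have h1 : x (t + 1) - ∑ τ ∈ Finset.range (t + 1), η τ =
        T (x t - ∑ τ ∈ Finset.range t, η τ) + (w t - T (w t)) := by
      rw [Finset.sum_range_succ, h, hw]
      simp only [map_sub]
      abel
    rw [h1, ih, map_add, map_sum, Finset.sum_range_succ', add_assoc]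
    refine congrArg₂ (· + ·) ?_ (congrArg₂ (· + ·) (Finset.sum_congr rfl fun k _ => ?_) ?_)
    · rw [pow_succ']; rfl
    · rw [show t + 1 - 1 - (k + 1) = t - 1 - k by omega, pow_succ', mul_assoc]
      rfl
    · rw [pow_zero, one_mul]; rfl

theorem norm_sub_pow_le_of_recursion (T : (V → ℝ) →L[ℝ] (V → ℝ)) {x r η : ℕ → V → ℝ}
    (h : ∀ t, x (t + 1) = T (x t) + (r t - T (r t)) + η t) {R N : ℝ}
    (hr : ∀ t, ‖r t‖ ≤ R) (hη : ∀ t, ‖∑ τ ∈ Finset.range t, η τ‖ ≤ N) (t : ℕ) :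
    ‖x t - (T ^ t) (x 0)‖ ≤ N + (R + N) * ∑ k ∈ Finset.range t, ‖T ^ k * (1 - T)‖ := by
  have e := sub_sum_eq_of_recursion T h t
  have e' : x t - (T ^ t) (x 0) = ∑ τ ∈ Finset.range t, η τ +
      ∑ k ∈ Finset.range t, (T ^ k * (1 - T))
        (r (t - 1 - k) - ∑ τ ∈ Finset.range (t - 1 - k), η τ) := by
    rw [← sub_eq_iff_eq_add', ← sub_eq_iff_eq_add'.2 e]; abel
  rw [e', Finset.mul_sum]
  refine (norm_add_le _ _).trans (add_le_add (hη t) ((norm_sum_le _ _).trans ?_))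
  refine Finset.sum_le_sum fun k _ => ?_
  calc _ ≤ ‖T ^ k * (1 - T)‖ * ‖r (t - 1 - k) - ∑ τ ∈ Finset.range (t - 1 - k), η τ‖ :=
        ContinuousLinearMap.le_opNorm _ _
    _ ≤ ‖T ^ k * (1 - T)‖ * (R + N) := by
        gcongr
        exact (norm_sub_le _ _).trans (add_le_add (hr _) (hη _))
    _ = _ := mul_comm _ _

end Perturbation

/-! ### Discrepancy and mixing time. -/

section Discrepancy

variable {V : Type*} [Fintype V] [Nonempty V]

theorem discrepancy_le_of_abs_sub_le {x : V → ℕ} {m B : ℝ} (h : ∀ u, |(x u : ℝ) - m| ≤ B) :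
    discrepancy x ≤ 2 * B := by
  obtain ⟨u, -, hu⟩ := Finset.exists_mem_eq_sup' Finset.univ_nonempty x
  obtain ⟨v, -, hv⟩ := Finset.exists_mem_eq_inf' Finset.univ_nonempty x
  rw [discrepancy, hu, hv]
  have h1 := (abs_le.1 (h u)).2
  have h2 := (abs_le.1 (h v)).1
  linarith

theorem norm_sub_min_le_discrepancy (x : V → ℕ) :
    ‖(fun u => (x u : ℝ) - (Finset.univ.inf' Finset.univ_nonempty x : ℕ))‖ ≤ discrepancy x := by
  have hmin : ∀ u, ((Finset.univ.inf' Finset.univ_nonempty x : ℕ) : ℝ) ≤ x u := fun u => by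
    exact_mod_cast Finset.inf'_le x (Finset.mem_univ u)
  have hmax : ∀ u, (x u : ℝ) ≤ (Finset.univ.sup' Finset.univ_nonempty x : ℕ) := fun u => by
    exact_mod_cast Finset.le_sup' x (Finset.mem_univ u)
  rw [discrepancy]
  obtain ⟨u₀⟩ := ‹Nonempty V›
  refine (pi_norm_le_iff_of_nonneg (by linarith [hmin u₀, hmax u₀])).2 fun u => ?_
  rw [Real.norm_of_nonneg (by linarith [hmin u])]
  linarith [hmax u]

theorem discrepancy_eq_zero_or_one_le (x : V → ℕ) : discrepancy x = 0 ∨ 1 ≤ discrepancy x := by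
  obtain ⟨u, -, hu⟩ := Finset.exists_mem_eq_inf' Finset.univ_nonempty x
  have h : Finset.univ.inf' Finset.univ_nonempty x ≤ Finset.univ.sup' Finset.univ_nonempty x := by
    rw [hu]; exact Finset.le_sup' x (Finset.mem_univ u)
  rw [discrepancy]
  rcases h.eq_or_lt with h | h
  · left; rw [h, sub_self]
  · right
    rw [le_sub_iff_add_le, add_comm]
    exact_mod_cast h

theorem pow_mul_sqrt_card_mul_le_one {μ K n : ℝ} (h1 : μ ≤ 1) (hμ : 0 < μ) (hn : 1 ≤ n)
    (hK : K = 0 ∨ 1 ≤ K) {t : ℕ} (ht : Real.log (K * n) / μ ≤ t) :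
    (1 - μ) ^ t * √n * K ≤ 1 := by
  -- For `K = 0` the time condition is vacuous, as `Real.log 0 = 0`, and the left side vanishes.
  rcases hK with rfl | hK
  · simp
  have hKn : 0 < K * n := by positivity
  have h2 : (1 - μ) ^ t ≤ (K * n)⁻¹ := by
    calc (1 - μ) ^ t ≤ Real.exp (-μ) ^ t :=
          pow_le_pow_left₀ (by linarith) (by linarith [Real.add_one_le_exp (-μ)]) t
      _ = Real.exp (-(t * μ)) := by rw [← Real.exp_nat_mul]; ring_nf
      _ ≤ Real.exp (-Real.log (K * n)) := by
          rw [div_le_iff₀ hμ] at ht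
          exact Real.exp_le_exp.2 (by linarith)
      _ = _ := by rw [Real.exp_neg, Real.exp_log hKn]
  have h3 : √n ≤ n := Real.sqrt_le_iff.2 ⟨by linarith, by nlinarith⟩
  calc (1 - μ) ^ t * √n * K ≤ (K * n)⁻¹ * n * K := by gcongr
    _ = 1 := by field_simp

end Discrepancy

/-! ### The balancer as a perturbed random walk. -/

section Model

variable {V : Type*} [Fintype V] {G : SimpleGraph V} [DecidableRel G.Adj] {s d : ℕ}

theorem sum_neighborSet_eq (u : V) (g : V → ℝ) :
    ∑ v : G.neighborSet u, g v = ∑ v ∈ G.neighborFinset u, g v := Finset.sum_set_coe _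

theorem card_neighborSet_of_regular (hG : G.IsRegularOfDegree d) (u : V) :
    Fintype.card (G.neighborSet u) = d := by
  rw [SimpleGraph.card_neighborSet_eq_degree]; exact hG u

/-- Without any edges or self-loops, a node with one token could not send it. -/
theorem Balancer.degree_add_pos [Nonempty V] (A : Balancer G s) (hG : G.IsRegularOfDegree d) :
    0 < d + s := by
  by_contra h
  obtain ⟨rfl, rfl⟩ : d = 0 ∧ s = 0 := by omega
  obtain ⟨u⟩ := ‹Nonempty V›
  have h := A.outflow_eq (fun _ => 1) 0 u
  have : IsEmpty (G.neighborSet u) :=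
    Fintype.card_eq_zero_iff.1 (card_neighborSet_of_regular hG u)
  simp [Flow.outflow, loadAfter] at h

/-- The mean number of tokens that a node sends over its original edges in one step. -/
noncomputable def Flow.meanOut (f : Flow G s) (u : V) : ℝ :=
  (∑ v : G.neighborSet u, (f u (Sum.inl v) : ℝ)) / Fintype.card (G.neighborSet u)

/-- The excess of the tokens that arrive at a node over the mean outflows of its neighbours. -/
noncomputable def Flow.edgeError (f : Flow G s) (u : V) : ℝ :=
  ∑ v : G.neighborSet u,
    ((f v.1 (Sum.inl ⟨u, SimpleGraph.Adj.symm v.2⟩) : ℝ) - f.meanOut v.1)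

/-- The tokens of a node that do not take part in a uniform distribution over all its edges. -/
noncomputable def Balancer.remainder (A : Balancer G s) (x : V → ℕ) (t : ℕ) (u : V) : ℝ :=
  A.load x t u - (G.degree u + s : ℕ) * (A.flow x t).meanOut u

theorem Balancer.load_eq (A : Balancer G s) (x : V → ℕ) (t : ℕ) (u : V) :
    (A.load x t u : ℝ) = ∑ v : G.neighborSet u, (A.flow x t u (Sum.inl v) : ℝ) +
      ∑ i : Fin s, (A.flow x t u (Sum.inr i) : ℝ) := by
  rw [Balancer.load, ← A.outflow_eq, Flow.outflow, Fintype.sum_sum_type]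
  push_cast
  rfl

theorem sum_flow_eq_mul_meanOut (hG : G.IsRegularOfDegree d) (hd : 0 < d) (f : Flow G s) (u : V) :
    ∑ v : G.neighborSet u, (f u (Sum.inl v) : ℝ) = d * f.meanOut u := by
  have : (d : ℝ) ≠ 0 := by exact_mod_cast hd.ne'
  rw [Flow.meanOut, card_neighborSet_of_regular hG, mul_div_cancel₀ _ this]

/-- With load `(d + s) * y + r`, the self-loops of `u` keep `s * y u + r u`, and the neighbours send
their `y` up to `edgeError`. So the walk acts on `load - r` only, and `r` stays in place. -/
theorem Balancer.load_succ [DecidableEq V] (A : Balancer G s) (hG : G.IsRegularOfDegree d)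
    (hd : 0 < d) (x : V → ℕ) (t : ℕ) :
    (fun u => (A.load x (t + 1) u : ℝ)) =
      walkOp G d s (fun u => (A.load x t u : ℝ)) +
        (A.remainder x t - walkOp G d s (A.remainder x t)) + (A.flow x t).edgeError := by
  have hD' : ((d + s : ℕ) : ℝ) ≠ 0 := by exact_mod_cast (by omega : d + s ≠ 0)
  set y := (A.flow x t).meanOut with hy
  have hsplit : (fun u => (A.load x t u : ℝ)) - A.remainder x t = ((d + s : ℕ) : ℝ) • y := by
    ext u
    simp only [Pi.sub_apply, Pi.smul_apply, Balancer.remainder, hG u, smul_eq_mul, ← hy]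
    ring
  have e : walkOp G d s (fun u => (A.load x t u : ℝ)) +
      (A.remainder x t - walkOp G d s (A.remainder x t)) =
      A.remainder x t + ((d + s : ℕ) : ℝ) • walkOp G d s y := by
    rw [← map_smul, ← hsplit, map_sub]; abel
  rw [e]
  ext u
  have h1 : (A.load x (t + 1) u : ℝ) = ∑ v : G.neighborSet u,
      (A.flow x t v.1 (Sum.inl ⟨u, SimpleGraph.Adj.symm v.2⟩) : ℝ) +
      ∑ i : Fin s, (A.flow x t u (Sum.inr i) : ℝ) := by
    change (((A.flow x t).inflow u : ℕ) : ℝ) = _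
    rw [Flow.inflow]; push_cast; rfl
  have h2 := A.load_eq x t u
  rw [sum_flow_eq_mul_meanOut hG hd] at h2
  have h3 := sum_neighborSet_eq (G := G) u y
  simp only [Pi.add_apply, Pi.smul_apply, smul_eq_mul, walkOp_apply, mul_div_cancel₀ _ hD',
    Flow.edgeError, Finset.sum_sub_distrib, Balancer.remainder, hG u, ← hy]
  rw [h1, ← h3]
  push_cast
  linarith

/-- The guaranteed `q` tokens per original edge bound the remainder from above, those per self-loop
from below; the load exceeds `(d + s) * q` by at most `d + s`. -/
theorem Balancer.IsCumulativelyFair.abs_remainder_le {A : Balancer G s} {δ : ℝ}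
    (hA : A.IsCumulativelyFair δ) (hG : G.IsRegularOfDegree d) (hd : 0 < d) (x : V → ℕ) (t : ℕ)
    (u : V) : |A.remainder x t u| ≤ ((d + s : ℕ) : ℝ) ^ 2 / d := by
  have hd' : (0 : ℝ) < d := by exact_mod_cast hd
  have hDpos : 0 < d + s := by omega
  have hfair := (hA x t u).1
  rw [hG u] at hfair
  set q := A.load x t u / (d + s) with hq
  have hload := A.load_eq x t u
  have hY : (d : ℝ) * q ≤ ∑ v : G.neighborSet u, (A.flow x t u (Sum.inl v) : ℝ) := by
    calc (d : ℝ) * q = ∑ _v : G.neighborSet u, (q : ℝ) := by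
          rw [Finset.sum_const, Finset.card_univ, card_neighborSet_of_regular hG, nsmul_eq_mul]
      _ ≤ _ := Finset.sum_le_sum fun v _ => by exact_mod_cast hfair (Sum.inl v)
  have hL : (s : ℝ) * q ≤ ∑ i : Fin s, (A.flow x t u (Sum.inr i) : ℝ) := by
    calc (s : ℝ) * q = ∑ _i : Fin s, (q : ℝ) := by
          rw [Finset.sum_const, Finset.card_univ, Fintype.card_fin, nsmul_eq_mul]
      _ ≤ _ := Finset.sum_le_sum fun i _ => by exact_mod_cast hfair (Sum.inr i)
  rw [sum_flow_eq_mul_meanOut hG hd] at hload hY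
  have hlt : (A.load x t u : ℝ) ≤ (d + s) * q + (d + s) := by
    have := Nat.lt_mul_div_succ (A.load x t u) hDpos
    rw [← hq] at this
    have : (A.load x t u : ℝ) < ((d + s) * (q + 1) : ℕ) := by exact_mod_cast this
    push_cast at this
    linarith
  have hs : (0 : ℝ) ≤ s := Nat.cast_nonneg s
  have e : A.remainder x t u * d =
      d * A.load x t u - (d + s) * (d * (A.flow x t).meanOut u) := by
    rw [Balancer.remainder, hG u]; push_cast; ring
  rw [le_div_iff₀ hd', ← abs_of_pos hd', ← abs_mul, e, abs_le]
  push_cast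
  constructor <;> nlinarith

theorem Balancer.IsCumulativelyFair.abs_sum_edgeError_le {A : Balancer G s} {δ : ℝ}
    (hA : A.IsCumulativelyFair δ) (hG : G.IsRegularOfDegree d) (hd : 0 < d) (x : V → ℕ) (t : ℕ)
    (u : V) : |∑ τ ∈ Finset.range t, (A.flow x τ).edgeError u| ≤ d * δ := by
  have hd' : (0 : ℝ) < d := by exact_mod_cast hd
  have e : ∑ τ ∈ Finset.range t, (A.flow x τ).edgeError u = ∑ v : G.neighborSet u,
      ((A.cumFlow x t v.1 (Sum.inl ⟨u, SimpleGraph.Adj.symm v.2⟩) : ℝ) -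
        ∑ τ ∈ Finset.range t, (A.flow x τ).meanOut v.1) := by
    simp only [Flow.edgeError]
    rw [Finset.sum_comm]
    refine Finset.sum_congr rfl fun v _ => ?_
    rw [Finset.sum_sub_distrib, Balancer.cumFlow]
    push_cast; rfl
  -- The accumulated `meanOut` is the average of the cumulative flows over the original edges of
  -- `v`, each within `δ` of the others.
  have hmean : ∀ v (w : G.neighborSet v), |(A.cumFlow x t v (Sum.inl w) : ℝ) -
      ∑ τ ∈ Finset.range t, (A.flow x τ).meanOut v| ≤ δ := by
    intro v w
    have e1 : (d : ℝ) * ((A.cumFlow x t v (Sum.inl w) : ℝ) -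
        ∑ τ ∈ Finset.range t, (A.flow x τ).meanOut v) =
        ∑ w' : G.neighborSet v,
          ((A.cumFlow x t v (Sum.inl w) : ℝ) - A.cumFlow x t v (Sum.inl w')) := by
      rw [mul_sub, Finset.mul_sum, Finset.sum_sub_distrib, Finset.sum_const, Finset.card_univ,
        card_neighborSet_of_regular hG, nsmul_eq_mul]
      congr 1
      rw [Finset.sum_congr rfl fun τ _ => (sum_flow_eq_mul_meanOut hG hd _ v).symm, Finset.sum_comm]
      refine Finset.sum_congr rfl fun w' _ => ?_
      rw [Balancer.cumFlow]; push_cast; rfl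
    have h2 : (d : ℝ) * |(A.cumFlow x t v (Sum.inl w) : ℝ) -
        ∑ τ ∈ Finset.range t, (A.flow x τ).meanOut v| ≤ d * δ := by
      rw [← abs_of_pos hd', ← abs_mul, abs_of_pos hd', e1]
      refine (Finset.abs_sum_le_sum_abs _ _).trans ?_
      refine (Finset.sum_le_sum fun w' _ => (hA x t v).2 w w').trans ?_
      rw [Finset.sum_const, Finset.card_univ, card_neighborSet_of_regular hG, nsmul_eq_mul]
    exact le_of_mul_le_mul_left h2 hd'
  rw [e]
  refine (Finset.abs_sum_le_sum_abs _ _).trans ((Finset.sum_le_sum fun v _ => hmean _ _).trans ?_)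
  rw [Finset.sum_const, Finset.card_univ, card_neighborSet_of_regular hG, nsmul_eq_mul]

/-- The discrepancy of a cumulatively fair balancer after the mixing time is controlled by the
variation of the powers of the walk. -/
theorem Balancer.IsCumulativelyFair.discrepancy_load_le [DecidableEq V] [Nonempty V]
    {A : Balancer G s} {δ : ℝ} (hA : A.IsCumulativelyFair δ) (hG : G.IsRegularOfDegree d)
    (hd : 0 < d) (hδ : 0 ≤ δ) (hμ : 0 < spectralGap G d s) (x : V → ℕ) {t : ℕ}
    (ht : Real.log (discrepancy x * Fintype.card V) / spectralGap G d s ≤ t) :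
    discrepancy (A.load x t) ≤ 2 * (1 + (d * δ + (((d + s : ℕ) : ℝ) ^ 2 / d + d * δ) *
      ∑ k ∈ Finset.range t, ‖walkOp G d s ^ k * (1 - walkOp G d s)‖)) := by
  have hD : 0 < d + s := by omega
  set T := walkOp G d s
  have hdev := norm_sub_pow_le_of_recursion T (x := fun t u => (A.load x t u : ℝ))
    (r := A.remainder x) (η := fun t => (A.flow x t).edgeError) (A.load_succ hG hd x)
    (R := ((d + s : ℕ) : ℝ) ^ 2 / d) (N := d * δ)
    (fun t => (pi_norm_le_iff_of_nonneg (by positivity)).2 fun u =>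
      hA.abs_remainder_le hG hd x t u)
    (fun t => (pi_norm_le_iff_of_nonneg (by positivity)).2 fun u => by
      rw [Finset.sum_apply]; exact hA.abs_sum_edgeError_le hG hd x t u) t
  -- Shifting by the minimal load makes the norm of the initial vector at most its discrepancy.
  set c : ℝ := ((Finset.univ.inf' Finset.univ_nonempty x : ℕ) : ℝ)
  set f : V → ℝ := fun u => (x u : ℝ) - c with hf
  have hinit : (T ^ t) (fun u => (x u : ℝ)) =
      (T ^ t) (f - fun _ => mean f) + fun _ => mean f + c := by
    have : (fun u => (x u : ℝ)) = (f - fun _ => mean f) + fun _ => mean f + c := by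
      ext u; simp only [Pi.add_apply, Pi.sub_apply]; ring
    conv_lhs => rw [this]
    rw [map_add, walkOp_pow_const hG hD]
  have hmix : ‖(T ^ t) (f - fun _ => mean f)‖ ≤ 1 := by
    refine (norm_walkOp_pow_sub_mean_le hG hD hμ f t).trans ?_
    have hle := spectralGap_le_one G d s
    refine (mul_le_mul_of_nonneg_left (norm_sub_min_le_discrepancy x)
      (mul_nonneg (pow_nonneg (by linarith) _) (Real.sqrt_nonneg _))).trans ?_
    exact pow_mul_sqrt_card_mul_le_one hle hμ (by exact_mod_cast Fintype.card_pos)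
      (discrepancy_eq_zero_or_one_le x) ht
  refine discrepancy_le_of_abs_sub_le (m := mean f + c) fun u => ?_
  have h1 := (norm_le_pi_norm _ u).trans hmix
  have h2 := (norm_le_pi_norm _ u).trans hdev
  have h3 : ((A.load x t u : ℝ) - (T ^ t) (fun u => (x u : ℝ)) u) +
      (T ^ t) (f - fun _ => mean f) u = A.load x t u - (mean f + c) := by
    rw [hinit, Pi.add_apply]; ring
  rw [← h3, add_comm]
  exact (abs_add_le _ _).trans (add_le_add h1 h2)

end Model


/-! ### The three bounds on the sum of variations. -/

theorem exists_halving_time {μ n : ℝ} (h1 : μ ≤ 1) (hμ : 0 < μ) (hn : 2 ≤ n) :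
    ∃ m : ℕ, (m : ℝ) ≤ 4 * (Real.log n / μ) ∧ (1 - μ) ^ m * √n ≤ 1 / 2 := by
  have hlog : 1 / 2 ≤ Real.log n := by
    have := Real.log_le_log (by norm_num) hn
    linarith [Real.log_two_gt_d9]
  have hL : 1 / 2 ≤ Real.log n / μ := by
    rw [le_div_iff₀ hμ]; linarith
  -- This exponent makes `(1 - μ) ^ m ≤ n ^ (-2)`. Rounding up costs at most `2 * (log n / μ)`, as
  -- `log n / μ ≥ 1 / 2`.
  refine ⟨⌈2 * (Real.log n / μ)⌉₊, ?_, ?_⟩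
  · have := Nat.ceil_lt_add_one (a := 2 * (Real.log n / μ)) (by linarith)
    linarith
  · set m := ⌈2 * (Real.log n / μ)⌉₊
    have hm : 2 * Real.log n ≤ m * μ := by
      calc 2 * Real.log n = 2 * (Real.log n / μ) * μ := by field_simp
        _ ≤ m * μ := by gcongr; exact Nat.le_ceil _
    have h2 : (1 - μ) ^ m ≤ (n * n)⁻¹ := by
      calc (1 - μ) ^ m ≤ Real.exp (-μ) ^ m :=
            pow_le_pow_left₀ (by linarith) (by linarith [Real.add_one_le_exp (-μ)]) m
        _ = Real.exp (-(m * μ)) := by rw [← Real.exp_nat_mul]; ring_nf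
        _ ≤ Real.exp (-Real.log n + -Real.log n) := Real.exp_le_exp.2 (by linarith)
        _ = _ := by
            rw [Real.exp_add, Real.exp_neg, Real.exp_log (by linarith), mul_inv]
    calc (1 - μ) ^ m * √n ≤ (n * n)⁻¹ * n := by
          gcongr
          exact Real.sqrt_le_iff.2 ⟨by linarith, by nlinarith⟩
      _ = 1 / n := by field_simp
      _ ≤ 1 / 2 := one_div_le_one_div_of_le (by norm_num) hn

section VariationSums

variable {V : Type*} [Fintype V] [DecidableEq V] [Nonempty V] {G : SimpleGraph V}
  [DecidableRel G.Adj] {d s : ℕ} (hG : G.IsRegularOfDegree d) (hD : 0 < d + s)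
  (hμ : 0 < spectralGap G d s)

include hG hD hμ

theorem sum_variation_le (hn : 2 ≤ Fintype.card V) (t : ℕ) :
    ∑ k ∈ Finset.range t, ‖walkOp G d s ^ k * (1 - walkOp G d s)‖ ≤
      16 * (Real.log (Fintype.card V) / spectralGap G d s) := by
  obtain ⟨m, hm, hhalf⟩ := exists_halving_time (spectralGap_le_one G d s) hμ
    (by exact_mod_cast hn : (2 : ℝ) ≤ Fintype.card V)
  have hT := norm_walkOp_le (s := s) hG hD
  refine (sum_range_le_two_mul_of_halving (fun k => norm_nonneg _)
    (norm_walkOp_pow_mul_one_sub_halving hG hD hμ hhalf) t).trans ?_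
  have h2 : ∑ k ∈ Finset.range m, ‖walkOp G d s ^ k * (1 - walkOp G d s)‖ ≤ m * 2 := by
    calc _ ≤ ∑ _k ∈ Finset.range m, (2 : ℝ) := Finset.sum_le_sum fun k _ => by
          calc _ ≤ ‖walkOp G d s ^ k‖ * ‖1 - walkOp G d s‖ := norm_mul_le _ _
            _ ≤ 1 * (1 + 1) := by
                gcongr
                · exact (norm_pow_le _ _).trans (pow_le_one₀ (norm_nonneg _) hT)
                · refine (norm_sub_le _ _).trans ?_
                  rw [norm_one]
                  gcongr
            _ = 2 := by norm_num
      _ = _ := by rw [Finset.sum_const, Finset.card_range, nsmul_eq_mul]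
  linarith

theorem sum_variation_le_sqrt (hds : d ≤ s) (hn : 2 ≤ Fintype.card V) (t : ℕ) :
    ∑ k ∈ Finset.range t, ‖walkOp G d s ^ k * (1 - walkOp G d s)‖ ≤
      16 * √(Real.log (Fintype.card V) / spectralGap G d s) := by
  obtain ⟨m, hm, hhalf⟩ := exists_halving_time (spectralGap_le_one G d s) hμ
    (by exact_mod_cast hn : (2 : ℝ) ≤ Fintype.card V)
  refine (sum_range_le_two_mul_of_halving (fun k => norm_nonneg _)
    (norm_walkOp_pow_mul_one_sub_halving hG hD hμ hhalf) t).trans ?_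
  have h2 : ∑ k ∈ Finset.range m, ‖walkOp G d s ^ k * (1 - walkOp G d s)‖ ≤ 2 * (2 * √m) := by
    refine le_trans ?_ (mul_le_mul_of_nonneg_left (sum_inv_sqrt_succ_le m) zero_le_two)
    rw [Finset.mul_sum]
    refine Finset.sum_le_sum fun k _ => ?_
    rw [mul_one_div]
    exact norm_lazy_pow_mul_one_sub_le' _ (norm_walkOp_le hG hD)
      (norm_two_mul_walkOp_sub_one_le hG hD hds) k
  have h3 : √(m : ℝ) ≤ 2 * √(Real.log (Fintype.card V) / spectralGap G d s) := by
    refine (Real.sqrt_le_sqrt hm).trans ?_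
    rw [Real.sqrt_mul (by norm_num), show (4 : ℝ) = 2 ^ 2 by norm_num,
      Real.sqrt_sq (by norm_num)]
  linarith

theorem sum_variation_le_sqrt_card (hds : d ≤ s) (hn : 2 ≤ Fintype.card V) {c : ℝ} (hc : 0 ≤ c)
    (hDn : ((d + s : ℕ) : ℝ) ≤ (1 + c) * Fintype.card V) (t : ℕ) :
    ∑ k ∈ Finset.range t, ‖walkOp G d s ^ k * (1 - walkOp G d s)‖ ≤
      (52 + 48 * c) * √(Fintype.card V) := by
  set n := Fintype.card V with hndef
  have hn0 : (0 : ℝ) < n := by exact_mod_cast (by omega : 0 < n)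
  set b : ℕ → ℝ := fun k => ‖walkOp G d s ^ k * (1 - walkOp G d s)‖ with hb
  have hb0 : ∀ k, 0 ≤ b k := fun k => norm_nonneg _
  -- Below `n` the lazy bound contributes `4 * √n`; from `n` on the Nash bound contributes `48 * (1
  -- + c) * √n`.
  have hsplit : ∑ k ∈ Finset.range t, b k ≤
      ∑ k ∈ Finset.range n, b k + ∑ k ∈ Finset.Ico n t, b k := by
    rcases le_total n t with h | h
    · rw [Finset.sum_range_add_sum_Ico _ h]
    · rw [Finset.Ico_eq_empty_of_le h, Finset.sum_empty, add_zero]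
      exact Finset.sum_le_sum_of_subset_of_nonneg (by simpa using h) fun k _ _ => hb0 k
  have h1 : ∑ k ∈ Finset.range n, b k ≤ 2 * (2 * √n) := by
    refine le_trans ?_ (mul_le_mul_of_nonneg_left (sum_inv_sqrt_succ_le n) zero_le_two)
    rw [Finset.mul_sum]
    refine Finset.sum_le_sum fun k _ => ?_
    rw [mul_one_div]
    exact norm_lazy_pow_mul_one_sub_le' _ (norm_walkOp_le hG hD)
      (norm_two_mul_walkOp_sub_one_le hG hD hds) k
  have h2 : ∑ k ∈ Finset.Ico n t, b k ≤ 6 * √n * √√((d + s : ℕ) : ℝ) * (8 / √√(n : ℝ)) := by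
    refine le_trans ?_ (mul_le_mul_of_nonneg_left
      (sum_Ico_inv_mul_fourthRoot_le (by omega : 0 < n) t) (by positivity))
    rw [Finset.mul_sum]
    exact Finset.sum_le_sum fun k hk => norm_walkOp_pow_mul_one_sub_le_of_two_le hG hD hμ hds
      (hn.trans (Finset.mem_Ico.1 hk).1)
  have h3 : √√((d + s : ℕ) : ℝ) ≤ (1 + c) * √√(n : ℝ) := by
    have hroot : ∀ y : ℝ, 1 ≤ y → √y ≤ y := fun y hy =>
      Real.sqrt_le_iff.2 ⟨by linarith, by nlinarith⟩
    have hone : (1 : ℝ) ≤ √(1 + c) := Real.one_le_sqrt.2 (by linarith)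
    calc √√((d + s : ℕ) : ℝ) ≤ √√((1 + c) * n) := by gcongr
      _ = √√(1 + c) * √√(n : ℝ) := by
          rw [Real.sqrt_mul (by linarith), Real.sqrt_mul (Real.sqrt_nonneg _)]
      _ ≤ _ := by
          gcongr
          exact (hroot _ hone).trans (hroot _ (by linarith))
  have h4 : 6 * √n * √√((d + s : ℕ) : ℝ) * (8 / √√(n : ℝ)) ≤ 48 * (1 + c) * √n := by
    have : 0 < √√(n : ℝ) := by positivity
    calc _ ≤ 6 * √n * ((1 + c) * √√(n : ℝ)) * (8 / √√(n : ℝ)) := by gcongr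
      _ = _ := by field_simp; ring
  linarith

end VariationSums

/-! ### Assembly of the constants. -/

theorem discrepancy_bound_arith {c δ d D S B κ : ℝ} (hc : 0 ≤ c) (hδ : 0 ≤ δ) (hd : 1 ≤ d)
    (hD0 : 0 ≤ D) (hD : D ≤ (1 + c) * d) (hκ : 0 ≤ κ) (hB : 1 / 2 ≤ B) (hS : S ≤ κ * B) :
    2 * (1 + (d * δ + (D ^ 2 / d + d * δ) * S)) ≤
      (8 + 2 * (1 + c) ^ 2 * κ) * ((δ + 1) * d * B) := by
  have h1 : D ^ 2 / d + d * δ ≤ (1 + c) ^ 2 * (d * (δ + 1)) := by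
    have : D ^ 2 / d ≤ (1 + c) ^ 2 * d := by
      rw [div_le_iff₀ (by linarith)]
      calc D ^ 2 ≤ ((1 + c) * d) ^ 2 := pow_le_pow_left₀ hD0 hD 2
        _ = _ := by ring
    have h2 : 1 * (d * δ) ≤ (1 + c) ^ 2 * (d * δ) := by
      gcongr
      nlinarith
    linarith
  have h2 : (D ^ 2 / d + d * δ) * S ≤ (1 + c) ^ 2 * (d * (δ + 1)) * (κ * B) := by
    calc _ ≤ (D ^ 2 / d + d * δ) * (κ * B) := by gcongr
      _ ≤ _ := by gcongr
  have h3 : d * (δ + 1) * (1 / 2) ≤ d * (δ + 1) * B := by gcongr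
  have h4 : 0 ≤ d * δ := by positivity
  linarith

end LoadBalancing

theorem theorem1 :
    ∃ C₁ : ℝ, 0 < C₁ ∧ ∀ c : ℝ, ∃ C₂ : ℝ, 0 < C₂ ∧
      ∀ (V : Type*) [Fintype V] [DecidableEq V] [Nonempty V]
        (G : SimpleGraph V) [DecidableRel G.Adj] (d s : ℕ),
        G.IsRegularOfDegree d → (s : ℝ) ≤ c * d → 0 < LoadBalancing.spectralGap G d s →
        ∀ (δ : ℝ) (A : LoadBalancing.Balancer G s), A.IsCumulativelyFair δ →
        ∀ (x : V → ℕ) (t : ℕ),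
          C₁ * (Real.log (LoadBalancing.discrepancy x * Fintype.card V) /
            LoadBalancing.spectralGap G d s) ≤ t →
          (2 * d ≤ d + s →
            LoadBalancing.discrepancy (A.load x t) ≤
              C₂ * ((δ + 1) * d *
                √(Real.log (Fintype.card V) / LoadBalancing.spectralGap G d s))) ∧
          (2 * d ≤ d + s →
            LoadBalancing.discrepancy (A.load x t) ≤
              C₂ * ((δ + 1) * d * √(Fintype.card V))) ∧
          (d + 1 ≤ d + s →
            LoadBalancing.discrepancy (A.load x t) ≤
              C₂ * ((δ + 1) * d *
                (Real.log (Fintype.card V) / LoadBalancing.spectralGap G d s))) := by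
  -- The factor `52 + 48 * |c|` comes from (ii) and exceeds the 16 of (i) and (iii); the absolute
  -- value keeps the constant positive for every `c`.
  refine ⟨1, one_pos, fun c => ⟨8 + 2 * (1 + |c|) ^ 2 * (52 + 48 * |c|), by positivity, ?_⟩⟩
  intro V _ _ _ G _ d s hG hsc hμ δ A hA x t ht
  rw [one_mul] at ht
  have hD := A.degree_add_pos hG
  have hd : 0 < d := by
    rcases Nat.eq_zero_or_pos d with rfl | h
    · have : (s : ℝ) ≤ 0 := by simpa using hsc
      have : s = 0 := by exact_mod_cast this.antisymm (Nat.cast_nonneg s)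
      omega
    · exact h
  have hd1 : (1 : ℝ) ≤ d := by exact_mod_cast hd
  obtain ⟨u⟩ := ‹Nonempty V›
  have hdn : d < Fintype.card V := by rw [← hG u]; exact G.degree_lt_card_verts u
  have hn : 2 ≤ Fintype.card V := by omega
  have hn' : (2 : ℝ) ≤ Fintype.card V := by exact_mod_cast hn
  have : Nonempty V := ⟨u⟩
  have hδ : 0 ≤ δ := by
    have hpos : 0 < Fintype.card (G.neighborSet u) := by
      rwa [LoadBalancing.card_neighborSet_of_regular hG]
    obtain ⟨v⟩ := Fintype.card_pos_iff.1 hpos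
    -- Comparing an edge with itself shows `0 ≤ δ`.
    exact (abs_nonneg _).trans ((hA x t u).2 v v)
  have hDd : ((d + s : ℕ) : ℝ) ≤ (1 + |c|) * d := by
    have : c * d ≤ |c| * d := by gcongr; exact le_abs_self c
    push_cast
    linarith
  have hDn : ((d + s : ℕ) : ℝ) ≤ (1 + |c|) * Fintype.card V := by
    refine hDd.trans ?_
    gcongr
  have hL : 1 / 2 ≤ Real.log (Fintype.card V) / LoadBalancing.spectralGap G d s := by
    have h1 := LoadBalancing.spectralGap_le_one G d s
    have h2 := Real.log_le_log (by norm_num) hn'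
    rw [le_div_iff₀ hμ]
    linarith [Real.log_two_gt_d9]
  have key : ∀ B : ℝ, 1 / 2 ≤ B →
      ∑ k ∈ Finset.range t, ‖LoadBalancing.walkOp G d s ^ k * (1 - LoadBalancing.walkOp G d s)‖ ≤
        (52 + 48 * |c|) * B →
      LoadBalancing.discrepancy (A.load x t) ≤
        (8 + 2 * (1 + |c|) ^ 2 * (52 + 48 * |c|)) * ((δ + 1) * d * B) := fun B hB hS =>
    (hA.discrepancy_load_le hG hd hδ hμ x ht).trans
      (LoadBalancing.discrepancy_bound_arith (abs_nonneg c) hδ hd1 (Nat.cast_nonneg _) hDd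
        (by positivity) hB hS)
  have h16 : ∀ B : ℝ, 1 / 2 ≤ B → 16 * B ≤ (52 + 48 * |c|) * B := fun B hB => by
    gcongr
    linarith [abs_nonneg c]
  refine ⟨fun hds => ?_, fun hds => ?_, fun _ => ?_⟩
  · have hB : 1 / 2 ≤ √(Real.log (Fintype.card V) / LoadBalancing.spectralGap G d s) :=
      Real.le_sqrt_of_sq_le (by linarith)
    exact key _ hB ((LoadBalancing.sum_variation_le_sqrt hG hD hμ (by omega) hn t).trans (h16 _ hB))
  · exact key _ (Real.le_sqrt_of_sq_le (by linarith))
      (LoadBalancing.sum_variation_le_sqrt_card hG hD hμ (by omega) hn (abs_nonneg c) hDn t)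
  · exact key _ hL ((LoadBalancing.sum_variation_le hG hD hμ hn t).trans (h16 _ hL))
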